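/- Let $r,p,s,q\in\mathbb Z$ with $rq-ps=-1$, let $\psi:S^1\times S^1\to S^1\times S^1$ be the diffeomorphism $\psi(\alpha,u)=(\alpha^r u^p,\alpha^s u^q)$, and let $L_{p,q}$ be the lens space obtained by gluing two solid tori along their boundaries via $\psi$. Concretely, as a closed smooth $3$-manifold, $L_{p,q}$ is obtained from two copies $T_0,T_1$ of the open solid torus $S^1\times\{z\in\mathbb C:|z|<1\}$ by identifying each $(\alpha,z)\in T_0$ with $z\neq0$ with the point $\bigl(\alpha^r u^p,\ \sqrt{1-|z|^2}\,\alpha^s u^q\bigr)\in T_1$, where $u=z/|z|$. Let $C_i\subset L_{p,q}$ be the central circle $S^1\times 0$ of $T_i$, $i=0,1$, let $f:L_{p,q}\to[0,1]$ be the smooth Morse–Bott function equal to $|z|^2$ on $T_0$ and to $1-|z|^2$ on $T_1$, and let $\mathcal F_{p,q}=\{f^{-1}(t)\mid t\in[0,1]\}$, a Morse–Bott foliation whose leaves are the two circles $C_0=f^{-1}(0)$, $C_1=f^{-1}(1)$ and the parallel $2$-tori $f^{-1}(t)$, $0<t<1$. Let $\mathcal D^{lp}$ be the group of $C^\infty$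 diffeomorphisms $h$ of $L_{p,q}$ such that $h(\omega)=\omega$ for each leaf $\omega\in\mathcal F_{p,q}$, and let $\mathcal D^{fol}_{+}$ be the group of $C^\infty$ diffeomorphisms $h$ of $L_{p,q}$ such that $h(\omega)\in\mathcal F_{p,q}$ for each $\omega\in\mathcal F_{p,q}$, and $h(C_i)=C_i$ for $i=0,1$. Endow both groups with the strong $C^\infty$ Whitney topology. Then $\mathcal D^{lp}\subset\mathcal D^{fol}_{+}$, and $\mathcal D^{lp}$ is a strong deformation retract of $\mathcal D^{fol}_{+}$: there is a continuous map $G:\mathcal D^{fol}_{+}\times[0,1]\to\mathcal D^{fol}_{+}$ such that $G(h,0)=h$ and $G(h,1)\in\mathcal D^{lp}$ for all $h\in\mathcal D^{fol}_{+}$, and $G(h,t)=h$ for all $h\in\mathcal D^{lp}$ and $t\in[0,1]$. -/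

import Mathlib

open Set Filter Topology Manifold
open scoped ContDiff

noncomputable section

/-! ### Strong deformation retracts -/

/-- `S` is a strong deformation retract of `X`: there is a homotopy, fixed on `S`, from the
identity of `X` to a map with values in `S`. -/
def IsStrongDeformationRetract {X : Type*} [TopologicalSpace X] (S : Set X) : Prop :=
  ∃ ρ : C(X, X), (∀ x, ρ x ∈ S) ∧ (ContinuousMap.id X).HomotopicRel ρ S

/-! ### Groups of diffeomorphisms with the strong Whitney topology -/

section Whitney

variable (E : Type) [NormedAddCommGroup E] [NormedSpace ℝ E]
  (M : Type) [TopologicalSpace M] [ChartedSpace E M]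

/-- The smooth self-maps of a manifold `M` (without boundary). -/
abbrev SmoothMaps : Type := C^∞⟮𝓘(ℝ, E), M; 𝓘(ℝ, E), M⟯

/-- The diffeomorphisms of `M`. -/
abbrev Diff : Type := M ≃ₘ^∞⟮𝓘(ℝ, E), 𝓘(ℝ, E)⟯ M

variable {E M}

/-- The maps `g` which send each `K i` to the domain of the chart `ψ i`, and there differ from `f`
by less than `ε i` in the charts `φ i`, `ψ i` together with all derivatives of order `≤ r`. -/
def strongNhd {ι : Type} (f : SmoothMaps E M) (φ ψ : ι → OpenPartialHomeomorph M E)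
    (K : ι → Set M) (ε : ι → ℝ) (r : ℕ) : Set (SmoothMaps E M) :=
  {g | ∀ i, ∀ x ∈ K i, g x ∈ (ψ i).source ∧ ∀ k ≤ r,
    ‖iteratedFDeriv ℝ k (ψ i ∘ g ∘ (φ i).symm) (φ i x) -
      iteratedFDeriv ℝ k (ψ i ∘ f ∘ (φ i).symm) (φ i x)‖ < ε i}

variable (E M)

/-- The strong `C^∞` Whitney topology: it is generated by the sets `strongNhd` for all smooth `f`,
all finite orders `r`, all locally finite families of charts `φ i`, all families of charts `ψ i`,
all compact sets `K i` inside the domain of `φ i` which `f` maps into the domain of `ψ i`, and all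
positive numbers `ε i`. -/
abbrev strongWhitneyTopology : TopologicalSpace (SmoothMaps E M) :=
  TopologicalSpace.generateFrom
    {N | ∃ (ι : Type) (f : SmoothMaps E M) (φ ψ : ι → OpenPartialHomeomorph M E)
      (K : ι → Set M) (ε : ι → ℝ) (r : ℕ),
      (∀ i, φ i ∈ IsManifold.maximalAtlas 𝓘(ℝ, E) ∞ M) ∧
      (∀ i, ψ i ∈ IsManifold.maximalAtlas 𝓘(ℝ, E) ∞ M) ∧
      LocallyFinite (fun i => (φ i).source) ∧
      (∀ i, IsCompact (K i) ∧ K i ⊆ (φ i).source ∧ MapsTo f (K i) (ψ i).source) ∧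
      (∀ i, 0 < ε i) ∧ N = strongNhd f φ ψ K ε r}

instance : TopologicalSpace (Diff E M) :=
  (strongWhitneyTopology E M).induced Diffeomorph.toContMDiffMap

/-- The group structure given by composition. -/
instance : Group (Diff E M) where
  mul g h := Diffeomorph.trans h g
  one := Diffeomorph.refl _ M ∞
  inv h := Diffeomorph.symm h
  mul_assoc _ _ _ := rfl
  one_mul _ := rfl
  mul_one _ := rfl
  inv_mul_cancel h := Diffeomorph.self_trans_symm h

variable {E M}

/-- A map is foliated with respect to a partition if it sends leaves to leaves. -/
def IsFoliated (F : Set (Set M)) (h : M → M) : Prop := ∀ l ∈ F, h '' l ∈ F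

/-- A map is leaf preserving with respect to a partition if it sends each leaf to itself. -/
def IsLeafPreserving (F : Set (Set M)) (h : M → M) : Prop := ∀ l ∈ F, h '' l = l

theorem Diff.coe_mul (g h : Diff E M) : ⇑(g * h) = g ∘ h := rfl

theorem Diff.coe_one : ⇑(1 : Diff E M) = id := rfl

theorem Diff.inv_image (h : Diff E M) {l l' : Set M} (hh : h '' l = l') :
    (h⁻¹ : Diff E M) '' l' = l := by
  rw [← hh]
  exact Diffeomorph.symm_image_image h l

/-- The group of foliated diffeomorphisms of a partition. -/
def foliatedDiff (F : Set (Set M)) (hF : Setoid.IsPartition F) : Subgroup (Diff E M) where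
  carrier := {h | IsFoliated F h}
  mul_mem' {g h} hg hh l hl := by
    rw [Diff.coe_mul, image_comp]
    exact hg _ (hh _ hl)
  one_mem' l hl := by rwa [Diff.coe_one, image_id]
  inv_mem' {h} hh l hl := by
    obtain ⟨x, hx⟩ : l.Nonempty := nonempty_iff_ne_empty.2 fun h0 => hF.1 (h0 ▸ hl)
    obtain ⟨l', ⟨hl', hx'⟩, -⟩ := hF.2 ((h⁻¹ : Diff E M) x)
    have hxh : x ∈ h '' l' := ⟨_, hx', Diffeomorph.apply_symm_apply h x⟩
    have : h '' l' = l := (hF.2 x).unique ⟨hh l' hl', hxh⟩ ⟨hl, hx⟩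
    rwa [Diff.inv_image h this]

/-- The group of leaf preserving diffeomorphisms of a partition. -/
def leafPreservingDiff (F : Set (Set M)) : Subgroup (Diff E M) where
  carrier := {h | IsLeafPreserving F h}
  mul_mem' {g h} hg hh l hl := by rw [Diff.coe_mul, image_comp, hh l hl, hg l hl]
  one_mem' l _ := by rw [Diff.coe_one, image_id]
  inv_mem' {h} hh l hl := Diff.inv_image h (hh l hl)

/-- The group of diffeomorphisms which leave the set `C` invariant. -/
def invariantDiff (C : Set M) : Subgroup (Diff E M) where
  carrier := {h | h '' C = C}
  mul_mem' {g h} (hg : g '' C = C) (hh : h '' C = C) := by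
    change (g * h) '' C = C
    rw [Diff.coe_mul, image_comp, hh, hg]
  one_mem' := by
    change (1 : Diff E M) '' C = C
    rw [Diff.coe_one, image_id]
  inv_mem' {h} hh := Diff.inv_image h hh

end Whitney

/-! ### The gluing map -/

/-- An integer matrix `[[r, p], [s, q]]` of determinant `-1`. -/
structure GluingMatrix where
  r : ℤ
  p : ℤ
  s : ℤ
  q : ℤ
  det : r * q - p * s = -1

/-- The inverse matrix. -/
def GluingMatrix.inv (A : GluingMatrix) : GluingMatrix where
  r := -A.q
  p := A.p
  s := A.s
  q := -A.r
  det := by linear_combination A.det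

/-- The direction `z / |z|` of a nonzero complex number, see `coe_dir`. -/
def dir (z : ℂ) : Circle := Circle.exp z.arg

/-- The gluing map `(α, z) ↦ √(1 - |z|²) · ψ(α, z / |z|)`, where
`ψ(α, u) = (α ^ r * u ^ p, α ^ s * u ^ q)` is the diffeomorphism of the 2-torus given by the
matrix `A`, and where a number `c` acts on a point `(α, z)` of `S¹ × ℂ` by `(α, c z)`.
It is only used for `0 < |z| < 1`. -/
def glue (A : GluingMatrix) (x : Circle × ℂ) : Circle × ℂ :=
  (x.1 ^ A.r * dir x.2 ^ A.p,
    (Real.sqrt (1 - ‖x.2‖ ^ 2) : ℂ) * ((x.1 ^ A.s * dir x.2 ^ A.q : Circle) : ℂ))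

theorem norm_mul_dir (z : ℂ) : (‖z‖ : ℂ) * (dir z : ℂ) = z := by
  simp [dir, Circle.coe_exp, Complex.norm_mul_exp_arg_mul_I]

theorem coe_dir {z : ℂ} (hz : z ≠ 0) : (dir z : ℂ) = z / ‖z‖ := by
  have h : (‖z‖ : ℂ) ≠ 0 := by simpa using hz
  rw [eq_div_iff h, mul_comm, norm_mul_dir]

theorem dir_mul {c : ℝ} (hc : 0 < c) (u : Circle) : dir ((c : ℂ) * u) = u := by
  rw [dir, Complex.arg_real_mul _ hc, Circle.exp_arg]

theorem norm_glue (A : GluingMatrix) (x : Circle × ℂ) :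
    ‖(glue A x).2‖ = Real.sqrt (1 - ‖x.2‖ ^ 2) := by
  rw [glue, norm_mul, Circle.norm_coe, mul_one, Complex.norm_real, Real.norm_eq_abs,
    abs_of_nonneg (Real.sqrt_nonneg _)]

theorem norm_glue_sq (A : GluingMatrix) {x : Circle × ℂ} (h1 : ‖x.2‖ < 1) :
    ‖(glue A x).2‖ ^ 2 = 1 - ‖x.2‖ ^ 2 := by
  rw [norm_glue, Real.sq_sqrt]
  nlinarith [norm_nonneg x.2]

theorem sqrt_pos_of_norm {z : ℂ} (h1 : ‖z‖ < 1) : 0 < Real.sqrt (1 - ‖z‖ ^ 2) :=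
  Real.sqrt_pos.2 (by nlinarith [norm_nonneg z])

theorem glue_ne_zero (A : GluingMatrix) {x : Circle × ℂ} (h1 : ‖x.2‖ < 1) :
    (glue A x).2 ≠ 0 := by
  rw [← norm_pos_iff, norm_glue]
  exact sqrt_pos_of_norm h1

theorem norm_glue_lt (A : GluingMatrix) {x : Circle × ℂ} (h0 : x.2 ≠ 0) :
    ‖(glue A x).2‖ < 1 := by
  rw [norm_glue, Real.sqrt_lt' one_pos]
  have := norm_pos_iff.2 h0
  nlinarith

theorem glue_inv_glue (A : GluingMatrix) {x : Circle × ℂ} (h1 : ‖x.2‖ < 1) :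
    glue A.inv (glue A x) = x := by
  have hd : dir (glue A x).2 = x.1 ^ A.s * dir x.2 ^ A.q := dir_mul (sqrt_pos_of_norm h1) _
  have hs : Real.sqrt (1 - ‖(glue A x).2‖ ^ 2) = ‖x.2‖ := by
    rw [norm_glue_sq A h1, sub_sub_cancel, Real.sqrt_sq (norm_nonneg _)]
  have key : ∀ (a u : Circle), (a ^ A.r * u ^ A.p) ^ (-A.q) * (a ^ A.s * u ^ A.q) ^ A.p = a ∧
      (a ^ A.r * u ^ A.p) ^ A.s * (a ^ A.s * u ^ A.q) ^ (-A.r) = u := by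
    intro a u
    simp only [mul_zpow, ← zpow_mul]
    constructor
    · rw [mul_mul_mul_comm, ← zpow_add, ← zpow_add,
        show A.r * -A.q + A.s * A.p = 1 by linear_combination -A.det,
        show A.p * -A.q + A.q * A.p = 0 by ring]
      simp
    · rw [mul_mul_mul_comm, ← zpow_add, ← zpow_add,
        show A.r * A.s + A.s * -A.r = 0 by ring,
        show A.p * A.s + A.q * -A.r = 1 by linear_combination -A.det]
      simp
  refine Prod.ext ?_ ?_
  · change (x.1 ^ A.r * dir x.2 ^ A.p) ^ (-A.q) * dir (glue A x).2 ^ A.p = x.1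
    rw [hd]
    exact (key _ _).1
  · change (Real.sqrt (1 - ‖(glue A x).2‖ ^ 2) : ℂ) *
      (((x.1 ^ A.r * dir x.2 ^ A.p) ^ A.s * dir (glue A x).2 ^ (-A.r) : Circle) : ℂ) = x.2
    rw [hd, hs, (key _ _).2, norm_mul_dir]

theorem GluingMatrix.inv_inv (A : GluingMatrix) : A.inv.inv = A := by
  cases A; simp [GluingMatrix.inv]

theorem continuousAt_dir {z : ℂ} (hz : z ≠ 0) : ContinuousAt dir z := by
  have hi : IsInducing (fun u : Circle => (u : ℂ)) := IsInducing.subtypeVal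
  rw [hi.continuousAt_iff]
  have h : ContinuousAt (fun w : ℂ => w / (‖w‖ : ℂ)) z :=
    continuousAt_id.div (by fun_prop) (by simpa using hz)
  refine h.congr ?_
  filter_upwards [isOpen_ne.mem_nhds hz] with w hw
  exact (coe_dir hw).symm

theorem continuousAt_glue (A : GluingMatrix) {x : Circle × ℂ} (h0 : x.2 ≠ 0) :
    ContinuousAt (glue A) x := by
  have hd : ContinuousAt (fun y : Circle × ℂ => dir y.2) x :=
    ContinuousAt.comp (f := Prod.snd) (continuousAt_dir h0) continuousAt_snd
  have hf : ContinuousAt (fun y : Circle × ℂ => y.1) x := continuousAt_fst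
  refine ContinuousAt.prodMk ((hf.zpow _).mul (hd.zpow _)) (ContinuousAt.mul (by fun_prop) ?_)
  exact ContinuousAt.comp (g := fun u : Circle => (u : ℂ)) (by fun_prop)
    ((hf.zpow _).mul (hd.zpow _))

/-! ### The lens space as a topological space -/

/-- The open solid torus `S¹ × {|z| < 1}`. -/
abbrev OpenSolidTorus : Type := {x : Circle × ℂ // ‖x.2‖ < 1}

/-- Two points of the disjoint union of two copies of the open solid torus are identified if
they are equal or correspond to each other under the gluing map of the punctured tori. -/
def LensRel (A : GluingMatrix) (a b : Fin 2 × OpenSolidTorus) : Prop :=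
  a = b ∨ (a.1 = 0 ∧ b.1 = 1 ∧ a.2.1.2 ≠ 0 ∧ b.2.1 = glue A a.2.1) ∨
    (b.1 = 0 ∧ a.1 = 1 ∧ b.2.1.2 ≠ 0 ∧ a.2.1 = glue A b.2.1)

/-- The gluing matrix seen from each of the two tori. -/
def GluingMatrix.side (A : GluingMatrix) (i : Fin 2) : GluingMatrix :=
  if i = 0 then A else A.inv

theorem lensRel_iff (A : GluingMatrix) (a b : Fin 2 × OpenSolidTorus) :
    LensRel A a b ↔
      a = b ∨ (a.1 ≠ b.1 ∧ a.2.1.2 ≠ 0 ∧ b.2.1 = glue (A.side a.1) a.2.1) := by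
  obtain ⟨i, x⟩ := a
  obtain ⟨j, y⟩ := b
  have h : x.1.2 ≠ 0 ∧ y.1 = glue A x.1 ↔ y.1.2 ≠ 0 ∧ x.1 = glue A.inv y.1 := by
    constructor
    · rintro ⟨_, h⟩
      exact ⟨by rw [h]; exact glue_ne_zero A x.2, by rw [h, glue_inv_glue A x.2]⟩
    · rintro ⟨_, h⟩
      refine ⟨by rw [h]; exact glue_ne_zero _ y.2, ?_⟩
      have := glue_inv_glue A.inv y.2
      rw [A.inv_inv] at this
      rw [h, this]
  have h' : y.1.2 ≠ 0 ∧ x.1 = glue A y.1 ↔ x.1.2 ≠ 0 ∧ y.1 = glue A.inv x.1 := by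
    constructor
    · rintro ⟨_, h⟩
      exact ⟨by rw [h]; exact glue_ne_zero A y.2, by rw [h, glue_inv_glue A y.2]⟩
    · rintro ⟨_, h⟩
      refine ⟨by rw [h]; exact glue_ne_zero _ x.2, ?_⟩
      have := glue_inv_glue A.inv x.2
      rw [A.inv_inv] at this
      rw [h, this]
  clear h
  fin_cases i <;> fin_cases j <;> simp [LensRel, GluingMatrix.side]
  simpa using h'

theorem lensRel_equivalence (A : GluingMatrix) : Equivalence (LensRel A) where
  refl _ := Or.inl rfl
  symm := by
    rintro a b (h | h | h)
    · exact Or.inl h.symm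
    · exact Or.inr (Or.inr h)
    · exact Or.inr (Or.inl h)
  trans := by
    intro a b c hab hbc
    rw [lensRel_iff] at *
    rcases hab with rfl | ⟨h1, h2, h3⟩
    · exact hbc
    rcases hbc with rfl | ⟨h4, h5, h6⟩
    · exact Or.inr ⟨h1, h2, h3⟩
    left
    obtain ⟨i, x⟩ := a
    obtain ⟨j, y⟩ := b
    obtain ⟨k, z⟩ := c
    dsimp only at *
    have hik : i = k := by omega
    have hs : A.side j = (A.side i).inv := by
      fin_cases i <;> fin_cases j <;> simp_all [GluingMatrix.side, GluingMatrix.inv_inv]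
    refine Prod.ext hik (Subtype.ext ?_)
    rw [h6, hs, h3, glue_inv_glue _ x.2]

/-- The equivalence relation of the gluing. -/
def lensSetoid (A : GluingMatrix) : Setoid (Fin 2 × OpenSolidTorus) :=
  ⟨LensRel A, lensRel_equivalence A⟩

/-- The lens space: two open solid tori glued along the complements of their central circles,
with the quotient topology. -/
def LensSpace (A : GluingMatrix) : Type := Quotient (lensSetoid A)

namespace LensSpace

variable (A : GluingMatrix)

instance : TopologicalSpace (LensSpace A) :=
  inferInstanceAs (TopologicalSpace (Quotient (lensSetoid A)))

/-- The inclusions of the two open solid tori into the lens space. -/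
def incl (i : Fin 2) (x : OpenSolidTorus) : LensSpace A :=
  Quotient.mk (lensSetoid A) (i, x)

theorem exists_incl (m : LensSpace A) : ∃ i x, incl A i x = m := by
  obtain ⟨⟨i, x⟩, h⟩ := Quotient.exists_rep m
  exact ⟨i, x, h⟩

theorem incl_eq_iff {i j : Fin 2} {x y : OpenSolidTorus} :
    incl A i x = incl A j y ↔
      (i = j ∧ x = y) ∨ (i ≠ j ∧ x.1.2 ≠ 0 ∧ y.1 = glue (A.side i) x.1) := by
  have h : incl A i x = incl A j y ↔ LensRel A (i, x) (j, y) :=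
    Quotient.eq (r := lensSetoid A)
  rw [h, lensRel_iff, Prod.mk.injEq]

theorem isOpenEmbedding_incl (i : Fin 2) : IsOpenEmbedding (incl A i) := by
  refine .of_continuous_injective_isOpenMap ?_ ?_ ?_
  · exact continuous_quotient_mk'.comp (Continuous.prodMk_right i)
  · intro x y h
    rw [incl_eq_iff] at h
    simpa using h
  · intro U hU
    have hop : IsOpen (Subtype.val '' U : Set (Circle × ℂ)) :=
      (isOpen_lt (f := fun x : Circle × ℂ => ‖x.2‖) (g := fun _ => 1) (by fun_prop)
        continuous_const).isOpenMap_subtype_val U hU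
    change IsOpen ((Quotient.mk (lensSetoid A)) ⁻¹' (incl A i '' U))
    rw [isOpen_iff_mem_nhds]
    rintro ⟨j, y⟩ ⟨x, hx, hxy⟩
    replace hxy : incl A j y = incl A i x := hxy.symm
    rw [incl_eq_iff] at hxy
    rcases hxy with ⟨rfl, rfl⟩ | ⟨hne, h0, hg⟩
    · have : ({j} : Set (Fin 2)) ×ˢ U ∈ 𝓝 (j, y) :=
        ((isOpen_discrete _).prod hU).mem_nhds ⟨rfl, hx⟩
      filter_upwards [this] with ⟨k, w⟩ hw
      obtain ⟨rfl, hw⟩ := hw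
      exact ⟨w, hw, rfl⟩
    · have h1 : ∀ᶠ w in 𝓝 y, glue (A.side j) w.1 ∈ (Subtype.val '' U : Set (Circle × ℂ)) :=
        ((continuousAt_glue (A.side j) h0).comp (f := Subtype.val)
          continuousAt_subtype_val).preimage_mem_nhds
          (hop.mem_nhds (by rw [Function.comp_apply, ← hg]; exact ⟨x, hx, rfl⟩))
      have h2 : ∀ᶠ w : OpenSolidTorus in 𝓝 y, w.1.2 ≠ 0 :=
        (isOpen_ne.preimage (continuous_snd.comp continuous_subtype_val)).mem_nhds h0
      have h3 : ∀ᶠ k : Fin 2 in 𝓝 j, k = j := by simp [nhds_discrete]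
      rw [nhds_prod_eq]
      filter_upwards [h3.prod_mk (h1.and h2)] with ⟨k, w⟩ hw
      obtain ⟨rfl, ⟨v, hv, hvw⟩, hw0⟩ := hw
      exact ⟨v, hv, ((incl_eq_iff A).2 (Or.inr ⟨hne, hw0, hvw⟩)).symm⟩

/-! ### The smooth structure

The charts are `incl i (c * e^{√-1 θ}, z) ↦ (θ, z)` for `|θ| < π`, `|z| < 1`. -/

/-- The angle `θ ∈ (-π, π)` relative to a point `c` as a chart of the circle. -/
def arcChart (c : Circle) : OpenPartialHomeomorph Circle ℝ where
  toFun u := Complex.arg ((u / c : Circle) : ℂ)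
  invFun θ := c * Circle.exp θ
  source := {u | ((u / c : Circle) : ℂ) ∈ Complex.slitPlane}
  target := Ioo (-Real.pi) Real.pi
  map_source' u hu := by
    rw [mem_ofPred_eq, Complex.mem_slitPlane_iff_arg] at hu
    exact ⟨Complex.neg_pi_lt_arg _, lt_of_le_of_ne (Complex.arg_le_pi _) hu.1⟩
  map_target' θ hθ := by
    rw [mem_ofPred_eq, mul_div_cancel_left, Complex.mem_slitPlane_iff_arg,
      Circle.arg_exp hθ.1 hθ.2.le]
    exact ⟨hθ.2.ne, Circle.coe_ne_zero _⟩
  left_inv' u _ := by rw [Circle.exp_arg, mul_div_cancel]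
  right_inv' θ hθ := by rw [mul_div_cancel_left, Circle.arg_exp hθ.1 hθ.2.le]
  open_source := Complex.isOpen_slitPlane.preimage (by fun_prop)
  open_target := isOpen_Ioo
  continuousOn_toFun := by
    intro u hu
    refine ContinuousAt.continuousWithinAt ?_
    exact ContinuousAt.comp (f := fun u : Circle => ((u / c : Circle) : ℂ))
      (Complex.continuousAt_arg hu) (by fun_prop)
  continuousOn_invFun := by fun_prop

instance : Nonempty OpenSolidTorus := ⟨⟨(1, 0), by simp⟩⟩

theorem isOpenEmbedding_val :
    IsOpenEmbedding (Subtype.val : OpenSolidTorus → Circle × ℂ) :=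
  (isOpen_lt (f := fun x : Circle × ℂ => ‖x.2‖) (g := fun _ => 1) (by fun_prop)
    continuous_const).isOpenEmbedding_subtypeVal

/-- The chart `(c * e^{√-1 θ}, z) ↦ (θ, z)` of the open solid torus. -/
def torusChart (c : Circle) : OpenPartialHomeomorph OpenSolidTorus (ℝ × ℂ) :=
  isOpenEmbedding_val.toOpenPartialHomeomorph.trans
    ((arcChart c).prod (OpenPartialHomeomorph.refl ℂ))

/-- The chart `incl i (c * e^{√-1 θ}, z) ↦ (θ, z)` of the lens space. -/
def lensChart (i : Fin 2) (c : Circle) : OpenPartialHomeomorph (LensSpace A) (ℝ × ℂ) :=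
  (isOpenEmbedding_incl A i).toOpenPartialHomeomorph.symm.trans (torusChart c)

theorem lensChart_incl (i : Fin 2) (c : Circle) (x : OpenSolidTorus) :
    lensChart A i c (incl A i x) = (Complex.arg ((x.1.1 / c : Circle) : ℂ), x.1.2) := by
  have h : (isOpenEmbedding_incl A i).toOpenPartialHomeomorph.symm (incl A i x) = x :=
    (isOpenEmbedding_incl A i).toOpenPartialHomeomorph_left_inv
  simp only [lensChart, OpenPartialHomeomorph.coe_trans, Function.comp_apply, h]
  rfl

theorem mem_lensChart_source (i : Fin 2) (c : Circle) (m : LensSpace A) :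
    m ∈ (lensChart A i c).source ↔
      ∃ x, incl A i x = m ∧ ((x.1.1 / c : Circle) : ℂ) ∈ Complex.slitPlane := by
  have h : ∀ x, (isOpenEmbedding_incl A i).toOpenPartialHomeomorph.symm (incl A i x) = x :=
    fun x => (isOpenEmbedding_incl A i).toOpenPartialHomeomorph_left_inv
  simp only [lensChart, torusChart, OpenPartialHomeomorph.trans_source,
    OpenPartialHomeomorph.symm_source, IsOpenEmbedding.toOpenPartialHomeomorph_target,
    IsOpenEmbedding.toOpenPartialHomeomorph_source, univ_inter, mem_inter_iff, mem_range,
    mem_preimage, OpenPartialHomeomorph.prod_source, OpenPartialHomeomorph.refl_source]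
  constructor
  · rintro ⟨⟨x, rfl⟩, hx⟩
    rw [h] at hx
    exact ⟨x, rfl, hx.1⟩
  · rintro ⟨x, rfl, hx⟩
    rw [h]
    exact ⟨⟨x, rfl⟩, hx, trivial⟩

theorem exists_lensChart (m : LensSpace A) : ∃ ic : Fin 2 × Circle,
    m ∈ (lensChart A ic.1 ic.2).source := by
  obtain ⟨i, x, rfl⟩ := exists_incl A m
  exact ⟨(i, x.1.1), (mem_lensChart_source A _ _ _).2 ⟨x, rfl, by simp⟩⟩

instance : ChartedSpace (ℝ × ℂ) (LensSpace A) where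
  atlas := range fun ic : Fin 2 × Circle => lensChart A ic.1 ic.2
  chartAt m := lensChart A (exists_lensChart A m).choose.1 (exists_lensChart A m).choose.2
  mem_chart_source m := (exists_lensChart A m).choose_spec
  chart_mem_atlas _ := mem_range_self _

theorem contDiffAt_coe_dir {z : ℂ} (hz : z ≠ 0) : ContDiffAt ℝ ∞ (fun w => (dir w : ℂ)) z := by
  have h1 : ContDiffAt ℝ ∞ (fun w : ℂ => (‖w‖ : ℂ)) z :=
    Complex.ofRealCLM.contDiff.contDiffAt.comp z (contDiffAt_id.norm ℝ hz)
  have h : ContDiffAt ℝ ∞ (fun w : ℂ => w * ((‖w‖ : ℂ))⁻¹) z :=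
    contDiffAt_id.mul (h1.inv (by simpa using hz))
  refine h.congr_of_eventuallyEq ?_
  filter_upwards [isOpen_ne.mem_nhds hz] with w hw
  rw [coe_dir hw, div_eq_mul_inv]

theorem contDiffAt_zpow_circle {E : Type*} [NormedAddCommGroup E] [NormedSpace ℝ E]
    {f : E → Circle} {x : E} (hf : ContDiffAt ℝ ∞ (fun y => (f y : ℂ)) x) (n : ℤ) :
    ContDiffAt ℝ ∞ (fun y => ((f y ^ n : Circle) : ℂ)) x := by
  have h : ContDiffAt ℝ ∞ (fun w : ℂ => w ^ n) ((f x : Circle) : ℂ) :=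
    (AnalyticAt.zpow (𝕜 := ℝ) analyticAt_id (Circle.coe_ne_zero _)).contDiffAt
  exact ContDiffAt.comp (g := fun w : ℂ => w ^ n) (f := fun y => (f y : ℂ)) x h hf

theorem contDiffAt_mul_circle {E : Type*} [NormedAddCommGroup E] [NormedSpace ℝ E]
    {f g : E → Circle} {x : E} (hf : ContDiffAt ℝ ∞ (fun y => (f y : ℂ)) x)
    (hg : ContDiffAt ℝ ∞ (fun y => (g y : ℂ)) x) :
    ContDiffAt ℝ ∞ (fun y => ((f y * g y : Circle) : ℂ)) x := by
  simpa only [Circle.coe_mul] using hf.mul hg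

theorem contDiffAt_arg_div {E : Type*} [NormedAddCommGroup E] [NormedSpace ℝ E]
    {f : E → Circle} {x : E} {d : Circle} (hf : ContDiffAt ℝ ∞ (fun y => (f y : ℂ)) x)
    (hx : ((f x / d : Circle) : ℂ) ∈ Complex.slitPlane) :
    ContDiffAt ℝ ∞ (fun y => Complex.arg ((f y / d : Circle) : ℂ)) x := by
  have h1 : ContDiffAt ℝ ∞ (fun y => ((f y / d : Circle) : ℂ)) x := by
    simpa only [div_eq_mul_inv, Circle.coe_mul] using
      hf.mul (contDiffAt_const (c := ((d⁻¹ : Circle) : ℂ)))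
  have h2 : ContDiffAt ℝ ∞ (fun w : ℂ => Complex.arg w) ((f x / d : Circle) : ℂ) := by
    have := Complex.imCLM.contDiff.contDiffAt.comp _
      ((Complex.contDiffAt_log hx (n := ∞)).restrict_scalars ℝ)
    exact this.congr_of_eventuallyEq (Eventually.of_forall fun w => (Complex.log_im w).symm)
  exact h2.comp x h1

theorem lensChart_compatible (i j : Fin 2) (c d : Circle) :
    ContDiffOn ℝ ∞ ((lensChart A j d) ∘ (lensChart A i c).symm)
      ((lensChart A i c).symm.trans (lensChart A j d)).source := by
  intro v hv
  obtain ⟨hv1, hv2⟩ := hv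
  have hv1' : v ∈ (lensChart A i c).target := hv1
  obtain ⟨x, hx, hxc⟩ := (mem_lensChart_source A i c _).1 ((lensChart A i c).map_target hv1')
  have hopen : ((lensChart A i c).symm.trans (lensChart A j d)).source ∈ 𝓝 v :=
    ((lensChart A i c).symm.trans (lensChart A j d)).open_source.mem_nhds ⟨hv1, hv2⟩
  -- the point of the torus with coordinates `w`
  let P : ℝ × ℂ → Circle × ℂ := fun w => (c * Circle.exp w.1, w.2)
  have hP : ∀ w ∈ (lensChart A i c).target, ∃ y : OpenSolidTorus,
      incl A i y = (lensChart A i c).symm w ∧ y.1 = P w := by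
    intro w hw
    obtain ⟨y, hy, hyc⟩ := (mem_lensChart_source A i c _).1 ((lensChart A i c).map_target hw)
    refine ⟨y, hy, ?_⟩
    have h := (lensChart A i c).right_inv hw
    rw [← hy, lensChart_incl] at h
    rw [← h]
    refine Prod.ext ?_ rfl
    change y.1.1 = c * Circle.exp (Complex.arg ((y.1.1 / c : Circle) : ℂ))
    rw [Circle.exp_arg, mul_div_cancel]
  have hP1 : ContDiffAt ℝ ∞ (fun w => ((P w).1 : ℂ)) v := by
    have : ContDiff ℝ ∞ fun w : ℝ × ℂ => (c : ℂ) * Complex.exp (w.1 * Complex.I) :=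
      contDiff_const.mul (Complex.contDiff_exp.comp
        ((Complex.ofRealCLM.contDiff.comp contDiff_fst).mul contDiff_const))
    simpa only [P, Circle.coe_mul, Circle.coe_exp] using this.contDiffAt
  refine ContDiffAt.contDiffWithinAt ?_
  by_cases hij : i = j
  · subst hij
    have hs : (((P v).1 / d : Circle) : ℂ) ∈ Complex.slitPlane := by
      obtain ⟨y, hy, hyP⟩ := hP v hv1'
      obtain ⟨z, hz, hzd⟩ := (mem_lensChart_source A i d _).1 hv2
      have : z = y := (isOpenEmbedding_incl A i).injective (hz.trans hy.symm)
      rw [← hyP, ← this]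
      exact hzd
    have h : ContDiffAt ℝ ∞
        (fun w : ℝ × ℂ => (Complex.arg (((P w).1 / d : Circle) : ℂ), w.2)) v :=
      (contDiffAt_arg_div hP1 hs).prodMk contDiffAt_snd
    refine h.congr_of_eventuallyEq ?_
    filter_upwards [hopen] with w hw
    obtain ⟨y, hy, hyP⟩ := hP w hw.1
    rw [Function.comp_apply, ← hy, lensChart_incl, hyP]
  · have hQ : ∀ w ∈ ((lensChart A i c).symm.trans (lensChart A j d)).source,
        w.2 ≠ 0 ∧ ‖w.2‖ < 1 ∧ ∃ z : OpenSolidTorus, incl A j z = (lensChart A i c).symm w ∧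
          z.1 = glue (A.side i) (P w) ∧ ((z.1.1 / d : Circle) : ℂ) ∈ Complex.slitPlane := by
      intro w hw
      obtain ⟨y, hy, hyP⟩ := hP w hw.1
      obtain ⟨z, hz, hzd⟩ := (mem_lensChart_source A j d _).1 hw.2
      have h := (incl_eq_iff A).1 (hy.trans hz.symm)
      rcases h with ⟨h, _⟩ | ⟨_, h0, hg⟩
      · exact absurd h hij
      have hy2 := y.2
      rw [hyP] at h0 hg hy2
      exact ⟨h0, hy2, z, hz, hg, hzd⟩
    obtain ⟨h0, h1, z, -, hz, hzd⟩ := hQ v ⟨hv1, hv2⟩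
    rw [hz] at hzd
    have hd : ContDiffAt ℝ ∞ (fun w => (dir (P w).2 : ℂ)) v :=
      (contDiffAt_coe_dir h0).comp (f := fun w : ℝ × ℂ => w.2) v contDiffAt_snd
    have hsq : ContDiffAt ℝ ∞ (fun w : ℝ × ℂ => (Real.sqrt (1 - ‖w.2‖ ^ 2) : ℂ)) v := by
      refine Complex.ofRealCLM.contDiff.contDiffAt.comp v
        (ContDiffAt.sqrt (contDiffAt_const.sub (contDiffAt_snd.norm_sq ℝ)) ?_)
      exact (Real.sqrt_pos.1 (sqrt_pos_of_norm h1)).ne'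
    have hg1 : ContDiffAt ℝ ∞ (fun w => ((glue (A.side i) (P w)).1 : ℂ)) v :=
      contDiffAt_mul_circle (contDiffAt_zpow_circle hP1 _) (contDiffAt_zpow_circle hd _)
    have hg2 : ContDiffAt ℝ ∞ (fun w => (glue (A.side i) (P w)).2) v :=
      hsq.mul
        (contDiffAt_mul_circle (contDiffAt_zpow_circle hP1 _) (contDiffAt_zpow_circle hd _))
    have h := (contDiffAt_arg_div hg1 hzd).prodMk hg2
    refine h.congr_of_eventuallyEq ?_
    filter_upwards [hopen] with w hw
    obtain ⟨-, -, y, hy, hyP, -⟩ := hQ w hw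
    rw [Function.comp_apply, ← hy, lensChart_incl, hyP]

instance : IsManifold 𝓘(ℝ, ℝ × ℂ) ∞ (LensSpace A) := by
  refine isManifold_of_contDiffOn _ _ _ ?_
  rintro _ _ ⟨⟨i, c⟩, rfl⟩ ⟨⟨j, d⟩, rfl⟩
  simpa using lensChart_compatible A i j c d

/-! ### The foliation -/

/-- The function equal to `|z|²` on the first torus and to `1 - |z|²` on the second one. -/
def height : LensSpace A → ℝ :=
  Quotient.lift (fun a : Fin 2 × OpenSolidTorus =>
      if a.1 = 0 then ‖a.2.1.2‖ ^ 2 else 1 - ‖a.2.1.2‖ ^ 2) (by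
    rintro ⟨i, x⟩ ⟨j, y⟩ (h | ⟨h0, h1, -, hg⟩ | ⟨h0, h1, -, hg⟩)
    · rw [h]
    · dsimp only at *
      simp [h0, h1, hg, norm_glue_sq A x.2]
    · dsimp only at *
      simp [h0, h1, hg, norm_glue_sq A y.2])

/-- The Morse-Bott foliation: the partition into the level sets of `height`. -/
def foliation : Set (Set (LensSpace A)) :=
  {l | ∃ t ∈ Icc (0 : ℝ) 1, l = height A ⁻¹' {t}}

/-- The central circles `S¹ × 0` of the two solid tori. -/
def centralCircle (i : Fin 2) : Set (LensSpace A) := incl A i '' {x | x.1.2 = 0}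

theorem height_mem (m : LensSpace A) : height A m ∈ Icc (0 : ℝ) 1 := by
  obtain ⟨i, x, rfl⟩ := exists_incl A m
  have h0 := norm_nonneg x.1.2
  have h1 := x.2
  change (if i = 0 then ‖x.1.2‖ ^ 2 else 1 - ‖x.1.2‖ ^ 2) ∈ Icc (0 : ℝ) 1
  split_ifs <;> constructor <;> nlinarith

theorem exists_height {t : ℝ} (ht : t ∈ Icc (0 : ℝ) 1) : ∃ m, height A m = t := by
  rcases ht.2.lt_or_eq with h | rfl
  · have h1 : ‖(1, (Real.sqrt t : ℂ)).2‖ = Real.sqrt t := by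
      simp [abs_of_nonneg (Real.sqrt_nonneg t)]
    refine ⟨incl A 0 ⟨(1, Real.sqrt t), ?_⟩, ?_⟩
    · rw [h1, Real.sqrt_lt' one_pos]
      simpa using h
    · change ‖(1, (Real.sqrt t : ℂ)).2‖ ^ 2 = t
      rw [h1, Real.sq_sqrt ht.1]
  · refine ⟨incl A 1 ⟨(1, 0), by simp⟩, ?_⟩
    change (if (1 : Fin 2) = 0 then ‖(0 : ℂ)‖ ^ 2 else 1 - ‖(0 : ℂ)‖ ^ 2) = 1
    simp

theorem isPartition_foliation : Setoid.IsPartition (foliation A) := by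
  constructor
  · rintro ⟨t, ht, h⟩
    obtain ⟨m, hm⟩ := exists_height A ht
    have : m ∈ (∅ : Set (LensSpace A)) := by rw [h]; exact hm
    exact this
  · intro m
    refine ⟨height A ⁻¹' {height A m}, ⟨⟨_, height_mem A m, rfl⟩, rfl⟩, ?_⟩
    rintro _ ⟨⟨t, -, rfl⟩, hm⟩
    rw [show height A m = t from hm]

/-- The group of leaf preserving diffeomorphisms of the lens space. -/
def diffLp : Subgroup (Diff (ℝ × ℂ) (LensSpace A)) := leafPreservingDiff (foliation A)

/-- The group of foliated diffeomorphisms of the lens space. -/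
def diffFol : Subgroup (Diff (ℝ × ℂ) (LensSpace A)) :=
  foliatedDiff (foliation A) (isPartition_foliation A)

/-- The group of foliated diffeomorphisms of the lens space which leave each of the two central
circles invariant. -/
def diffFolPlus : Subgroup (Diff (ℝ × ℂ) (LensSpace A)) :=
  diffFol A ⊓ ⨅ i, invariantDiff (centralCircle A i)

end LensSpace

end

/-! ### Families of smooth maps depending continuously on a parameter -/

/-! Write `f` for the height. A foliated diffeomorphism `h` fixing both central circles setwise acts
on the leaf space `[0,1]`: `f ∘ h = σ ∘ f` with `σ` continuous, increasing and fixing the endpoints.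
The interval of heights is convex, so `σ` can be joined to the identity linearly. The isotopy lifts
to the lens space because a point can be slid along the ray of its solid torus, keeping its angular
coordinates: `deform t h` sends `m` to the point on the ray of `h m` at height `(1 - t) f (h m) + t
f m`. At `t = 0` this is `h`, at `t = 1` it preserves every leaf, and if `f ∘ h = f` nothing moves.

The difficulty is regularity at the central circles. On a meridian disc the function `K z = f (h z)`
(`discHeight`) is smooth, depends only on `|z|` and vanishes at `0`, so `K = |z|² Q` with `Q` smooth
(`exists_radial_quotient`). Since `h⁻¹` has the same property, `Q > 0` also at the centre
(`discQuotient_pos`). Sliding therefore multiplies `z` by the square root of a smooth positive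
function, which is smooth across `z = 0`. Its differential is injective because `K` has positive
radial derivative off the centre (`fderiv_discHeight_pos`), and bijectivity is seen on heights
(`bijective_stretch`); so each stretching map is a diffeomorphism.

For continuity in `(t, h)`, the Whitney topology is traded for families of maps all of whose space
derivatives are jointly continuous in parameter and point. `familySmoothOn_eval` goes from the
topology to families, and `continuous_strongWhitney_of_charts` goes back, using compactness. Such
families are closed under composition, products and integrals over `[0,1]`, hence under passing from
`K` to `Q`, and `lensChart_deform` writes the deformation through `h`, `Q` and `t`. -/

section Family

variable {Y Z E F G H : Type} [TopologicalSpace Y] [TopologicalSpace Z]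
  [NormedAddCommGroup E] [NormedSpace ℝ E] [NormedAddCommGroup F] [NormedSpace ℝ F]
  [NormedAddCommGroup G] [NormedSpace ℝ G] [NormedAddCommGroup H] [NormedSpace ℝ H]

/-- The maps `u y` are `n` times differentiable on the slices of `U`, and their derivatives of
order at most `n` are continuous on `U` as functions of the parameter and the point. -/
def FamilyContDiffOn : ℕ → ∀ {F : Type} [NormedAddCommGroup F] [NormedSpace ℝ F],
    (Y → E → F) → Set (Y × E) → Prop
  | 0, _, _, _, u, U => ContinuousOn (fun p : Y × E => u p.1 p.2) U
  | n + 1, _, _, _, u, U => ContinuousOn (fun p : Y × E => u p.1 p.2) U ∧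
      (∀ p ∈ U, DifferentiableAt ℝ (u p.1) p.2) ∧
      FamilyContDiffOn n (fun y x => fderiv ℝ (u y) x) U

/-- The maps `u y` are smooth on the slices of `U`, and all their derivatives are continuous on `U`
as functions of the parameter and the point. -/
def FamilySmoothOn (u : Y → E → F) (U : Set (Y × E)) : Prop := ∀ n, FamilyContDiffOn n u U

namespace FamilyContDiffOn

variable {n : ℕ} {U V : Set (Y × E)} {u v : Y → E → F}

theorem continuousOn (h : FamilyContDiffOn n u U) :
    ContinuousOn (fun p : Y × E => u p.1 p.2) U := by
  cases n with
  | zero => exact h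
  | succ n => exact h.1

theorem of_succ (h : FamilyContDiffOn (n + 1) u U) : FamilyContDiffOn n u U := by
  induction n generalizing F with
  | zero => exact h.1
  | succ n ih => exact ⟨h.1, h.2.1, ih h.2.2⟩

theorem mono (h : FamilyContDiffOn n u U) (hVU : V ⊆ U) : FamilyContDiffOn n u V := by
  induction n generalizing F with
  | zero => exact ContinuousOn.mono h hVU
  | succ n ih => exact ⟨h.1.mono hVU, fun p hp => h.2.1 p (hVU hp), ih h.2.2⟩

theorem eventually_slice {X : Type} [TopologicalSpace X] {U : Set (Y × X)} (hU : IsOpen U)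
    {p : Y × X} (hp : p ∈ U) : ∀ᶠ x in 𝓝 p.2, (p.1, x) ∈ U :=
  (Continuous.prodMk_right p.1).continuousAt.preimage_mem_nhds (hU.mem_nhds hp)

/-- Openness makes each slice of `U` a neighbourhood of its points, so equality on `U` passes to the
derivatives. -/
theorem congr (h : FamilyContDiffOn n v U) (hU : IsOpen U)
    (huv : ∀ p ∈ U, u p.1 p.2 = v p.1 p.2) : FamilyContDiffOn n u U := by
  induction n generalizing F with
  | zero => exact ContinuousOn.congr h huv
  | succ n ih =>
    have key : ∀ p ∈ U, u p.1 =ᶠ[𝓝 p.2] v p.1 := fun p hp => by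
      filter_upwards [eventually_slice hU hp] with x hx using huv _ hx
    exact ⟨h.1.congr huv, fun p hp => (h.2.1 p hp).congr_of_eventuallyEq (key p hp),
      ih h.2.2 fun p hp => (key p hp).fderiv_eq⟩

theorem of_locally (h : ∀ p ∈ U, ∃ V, IsOpen V ∧ p ∈ V ∧ FamilyContDiffOn n u V) :
    FamilyContDiffOn n u U := by
  have hc : ∀ m, (∀ p ∈ U, ∃ V, IsOpen V ∧ p ∈ V ∧ FamilyContDiffOn m u V) →
      ContinuousOn (fun p : Y × E => u p.1 p.2) U := fun m h p hp => by
    obtain ⟨V, hV, hpV, hu⟩ := h p hp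
    exact (hu.continuousOn.continuousAt (hV.mem_nhds hpV)).continuousWithinAt
  induction n generalizing F with
  | zero => exact hc 0 h
  | succ n ih =>
    refine ⟨hc _ h, fun p hp => ?_, ih (fun p hp => ?_) ?_⟩
    · obtain ⟨V, hV, hpV, hu⟩ := h p hp
      exact hu.2.1 p hpV
    · obtain ⟨V, hV, hpV, hu⟩ := h p hp
      exact ⟨V, hV, hpV, hu.2.2⟩
    · intro m h' p hp
      obtain ⟨V, hV, hpV, hu⟩ := h p hp
      exact (hu.2.2.continuousOn.continuousAt (hV.mem_nhds hpV)).continuousWithinAt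

theorem zero : FamilyContDiffOn n (fun (_ : Y) (_ : E) => (0 : F)) U := by
  induction n generalizing F with
  | zero => exact continuousOn_const
  | succ n ih =>
    refine ⟨continuousOn_const, fun _ _ => differentiableAt_const _, ?_⟩
    simpa using ih (F := E →L[ℝ] F)

theorem of_param {a : Y → F} (ha : Continuous a) :
    FamilyContDiffOn n (fun (y : Y) (_ : E) => a y) U := by
  cases n with
  | zero => exact (ha.comp continuous_fst).continuousOn
  | succ n =>
    refine ⟨(ha.comp continuous_fst).continuousOn, fun _ _ => differentiableAt_const _, ?_⟩
    simpa using zero (F := E →L[ℝ] F)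

theorem reparam (h : FamilyContDiffOn n u U) {a : Z → Y} (ha : Continuous a) :
    FamilyContDiffOn n (fun z => u (a z)) {p : Z × E | (a p.1, p.2) ∈ U} := by
  have hc : Continuous fun p : Z × E => (a p.1, p.2) := by fun_prop
  induction n generalizing F with
  | zero => exact ContinuousOn.comp h hc.continuousOn fun _ hp => hp
  | succ n ih =>
    exact ⟨ContinuousOn.comp (g := fun p : Y × E => u p.1 p.2) h.1 hc.continuousOn
      fun _ hp => hp, fun p hp => h.2.1 _ hp, ih h.2.2⟩

theorem add (hu : FamilyContDiffOn n u U) (hv : FamilyContDiffOn n v U) (hU : IsOpen U) :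
    FamilyContDiffOn n (fun y x => u y x + v y x) U := by
  induction n generalizing F with
  | zero => exact ContinuousOn.add hu hv
  | succ n ih =>
    refine ⟨hu.1.add hv.1, fun p hp => (hu.2.1 p hp).add (hv.2.1 p hp),
      (ih hu.2.2 hv.2.2).congr hU fun p hp => ?_⟩
    exact fderiv_add (hu.2.1 p hp) (hv.2.1 p hp)

theorem clm_apply (L : F →L[ℝ] G) (hu : FamilyContDiffOn n u U) (hU : IsOpen U) :
    FamilyContDiffOn n (fun y x => L (u y x)) U := by
  induction n generalizing F G with
  | zero => exact L.continuous.comp_continuousOn hu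
  | succ n ih =>
    refine ⟨L.continuous.comp_continuousOn hu.1,
      fun p hp => L.differentiableAt.comp _ (hu.2.1 p hp),
      (ih (ContinuousLinearMap.compL ℝ E F G L) hu.2.2).congr hU fun p hp => ?_⟩
    exact L.hasFDerivAt.comp _ (hu.2.1 p hp).hasFDerivAt |>.fderiv

theorem prodMk {v : Y → E → G} (hu : FamilyContDiffOn n u U) (hv : FamilyContDiffOn n v U)
    (hU : IsOpen U) : FamilyContDiffOn n (fun y x => (u y x, v y x)) U := by
  refine ((hu.clm_apply (ContinuousLinearMap.inl ℝ F G) hU).add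
    (hv.clm_apply (ContinuousLinearMap.inr ℝ F G) hU) hU).congr hU fun p _ => ?_
  simp

/-- Leibniz rule. The derivative is a sum of two pairings of the same kind with other bilinear maps,
which is why the induction generalizes over all three target spaces. -/
theorem bilinear (B : F →L[ℝ] G →L[ℝ] H) {v : Y → E → G} (hu : FamilyContDiffOn n u U)
    (hv : FamilyContDiffOn n v U) (hU : IsOpen U) :
    FamilyContDiffOn n (fun y x => B (u y x) (v y x)) U := by
  have hc : ∀ {F G H : Type} [NormedAddCommGroup F] [NormedSpace ℝ F]
      [NormedAddCommGroup G] [NormedSpace ℝ G] [NormedAddCommGroup H] [NormedSpace ℝ H]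
      (B : F →L[ℝ] G →L[ℝ] H) {u : Y → E → F} {v : Y → E → G},
      ContinuousOn (fun p : Y × E => u p.1 p.2) U → ContinuousOn (fun p : Y × E => v p.1 p.2) U →
      ContinuousOn (fun p : Y × E => B (u p.1 p.2) (v p.1 p.2)) U := fun B u v hu hv =>
    B.continuous₂.comp_continuousOn (hu.prodMk hv)
  induction n generalizing F G H with
  | zero => exact hc B hu hv
  | succ n ih =>
    refine ⟨hc B hu.1 hv.1, fun p hp => ?_, ((ih (B.precompR E) hu.of_succ hv.2.2).add
      (ih (B.precompL E) hu.2.2 hv.of_succ) hU).congr hU fun p hp => ?_⟩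
    · exact (B.hasFDerivAt_of_bilinear (hu.2.1 p hp).hasFDerivAt
        (hv.2.1 p hp).hasFDerivAt).differentiableAt
    · exact B.fderiv_of_bilinear (hu.2.1 p hp) (hv.2.1 p hp)

/-- Chain rule: the derivative is the pairing, by composition of linear maps, of a composite of
lower order with the derivative of `u`. -/
theorem comp {v : Y → F → G} {V : Set (Y × F)} (hv : FamilyContDiffOn n v V)
    (hu : FamilyContDiffOn n u U) (hU : IsOpen U) (hUV : ∀ p ∈ U, (p.1, u p.1 p.2) ∈ V) :
    FamilyContDiffOn n (fun y x => v y (u y x)) U := by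
  have hc : ∀ {G : Type} [NormedAddCommGroup G] {v : Y → F → G},
      ContinuousOn (fun p : Y × E => u p.1 p.2) U → ContinuousOn (fun p : Y × F => v p.1 p.2) V →
      ContinuousOn (fun p : Y × E => v p.1 (u p.1 p.2)) U := fun hu hv =>
    hv.comp (continuousOn_fst.prodMk hu) hUV
  induction n generalizing G with
  | zero => exact hc hu hv
  | succ n ih =>
    refine ⟨hc hu.1 hv.1, fun p hp => DifferentiableAt.comp (g := v p.1) p.2
      (hv.2.1 _ (hUV p hp)) (hu.2.1 p hp),
      ((ih hv.2.2 hu.of_succ).bilinear (ContinuousLinearMap.compL ℝ E F G) hu.2.2 hU).congr hU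
        fun p hp => ?_⟩
    exact fderiv_comp (g := v p.1) p.2 (hv.2.1 _ (hUV p hp)) (hu.2.1 p hp)

theorem continuousOn_iteratedFDeriv (h : FamilyContDiffOn n u U) {k : ℕ} (hk : k ≤ n) :
    ContinuousOn (fun p : Y × E => iteratedFDeriv ℝ k (u p.1) p.2) U := by
  induction n generalizing F k with
  | zero =>
    obtain rfl : k = 0 := by omega
    simp only [iteratedFDeriv_zero_eq_comp]
    exact (LinearIsometryEquiv.continuous _).comp_continuousOn h
  | succ n ih =>
    cases k with
    | zero =>
      simp only [iteratedFDeriv_zero_eq_comp]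
      exact (LinearIsometryEquiv.continuous _).comp_continuousOn h.1
    | succ k =>
      simp only [iteratedFDeriv_succ_eq_comp_right]
      exact (LinearIsometryEquiv.continuous _).comp_continuousOn (ih h.2.2 (by omega))

/-- With `continuousOn_iteratedFDeriv`, this translates between the recursive notion, suited to
inductions, and the iterated derivatives in which the Whitney topology is phrased. -/
theorem of_iteratedFDeriv (hs : ∀ p ∈ U, ContDiffAt ℝ ∞ (u p.1) p.2)
    (hc : ∀ k, ContinuousOn (fun p : Y × E => iteratedFDeriv ℝ k (u p.1) p.2) U) :
    FamilyContDiffOn n u U := by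
  have h0 : ContinuousOn (fun p : Y × E => u p.1 p.2) U := by
    have := (continuousMultilinearCurryFin0 ℝ E F).continuous.comp_continuousOn (hc 0)
    exact this.congr fun p _ => by simp [iteratedFDeriv_zero_eq_comp]
  induction n generalizing F with
  | zero => exact h0
  | succ n ih =>
    have hc' : ∀ k, ContinuousOn
        (fun p : Y × E => iteratedFDeriv ℝ k (fun x => fderiv ℝ (u p.1) x) p.2) U := fun k => by
      have := (continuousMultilinearCurryRightEquiv' ℝ k E F).continuous.comp_continuousOn
        (hc (k + 1))
      exact this.congr fun p _ => by
        simp only [iteratedFDeriv_succ_eq_comp_right, Function.comp_apply,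
          LinearIsometryEquiv.apply_symm_apply]
    refine ⟨h0, fun p hp => (hs p hp).differentiableAt (by simp), ih ?_ hc' ?_⟩
    · exact fun p hp => (hs p hp).fderiv_right (by simp)
    · have := (continuousMultilinearCurryFin0 ℝ E (E →L[ℝ] F)).continuous.comp_continuousOn (hc' 0)
      exact this.congr fun p _ => by simp [iteratedFDeriv_zero_eq_comp]

theorem contDiffOn_slice (h : FamilyContDiffOn n u U) (hU : IsOpen U) (y : Y) :
    ContDiffOn ℝ n (u y) {x | (y, x) ∈ U} := by
  have ho : IsOpen {x | (y, x) ∈ U} := hU.preimage (Continuous.prodMk_right y)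
  have hc : ContinuousOn (u y) {x | (y, x) ∈ U} :=
    h.continuousOn.comp (Continuous.prodMk_right y).continuousOn fun _ hx => hx
  induction n generalizing F with
  | zero => exact_mod_cast contDiffOn_zero.2 hc
  | succ n ih =>
    push_cast
    refine (contDiffOn_succ_iff_fderiv_of_isOpen ho).2 ⟨fun x hx =>
      (h.2.1 _ hx).differentiableWithinAt, by simp, ih h.2.2 ?_⟩
    exact h.2.2.continuousOn.comp (Continuous.prodMk_right y).continuousOn fun _ hx => hx

end FamilyContDiffOn

namespace FamilySmoothOn

variable {U V : Set (Y × E)} {u v : Y → E → F}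

theorem continuousOn (h : FamilySmoothOn u U) :
    ContinuousOn (fun p : Y × E => u p.1 p.2) U := h 0

theorem mono (h : FamilySmoothOn u U) (hVU : V ⊆ U) : FamilySmoothOn u V :=
  fun n => (h n).mono hVU

theorem congr (h : FamilySmoothOn v U) (hU : IsOpen U)
    (huv : ∀ p ∈ U, u p.1 p.2 = v p.1 p.2) : FamilySmoothOn u U :=
  fun n => (h n).congr hU huv

theorem of_locally (h : ∀ p ∈ U, ∃ V, IsOpen V ∧ p ∈ V ∧ FamilySmoothOn u V) :
    FamilySmoothOn u U := fun n => .of_locally fun p hp => by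
  obtain ⟨V, hV, hpV, hu⟩ := h p hp
  exact ⟨V, hV, hpV, hu n⟩

theorem of_param {a : Y → F} (ha : Continuous a) :
    FamilySmoothOn (fun (y : Y) (_ : E) => a y) U := fun _ => .of_param ha

theorem reparam (h : FamilySmoothOn u U) {a : Z → Y} (ha : Continuous a) :
    FamilySmoothOn (fun z => u (a z)) {p : Z × E | (a p.1, p.2) ∈ U} := fun n => (h n).reparam ha

theorem add (hu : FamilySmoothOn u U) (hv : FamilySmoothOn v U) (hU : IsOpen U) :
    FamilySmoothOn (fun y x => u y x + v y x) U := fun n => (hu n).add (hv n) hU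

theorem clm_apply (L : F →L[ℝ] G) (hu : FamilySmoothOn u U) (hU : IsOpen U) :
    FamilySmoothOn (fun y x => L (u y x)) U := fun n => (hu n).clm_apply L hU

theorem prodMk {v : Y → E → G} (hu : FamilySmoothOn u U) (hv : FamilySmoothOn v U)
    (hU : IsOpen U) : FamilySmoothOn (fun y x => (u y x, v y x)) U :=
  fun n => (hu n).prodMk (hv n) hU

theorem bilinear (B : F →L[ℝ] G →L[ℝ] H) {v : Y → E → G} (hu : FamilySmoothOn u U)
    (hv : FamilySmoothOn v U) (hU : IsOpen U) :
    FamilySmoothOn (fun y x => B (u y x) (v y x)) U := fun n => (hu n).bilinear B (hv n) hU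

theorem smul {a : Y → E → ℝ} (ha : FamilySmoothOn a U) (hu : FamilySmoothOn u U)
    (hU : IsOpen U) : FamilySmoothOn (fun y x => a y x • u y x) U :=
  ha.bilinear (ContinuousLinearMap.lsmul ℝ ℝ) hu hU

theorem comp {v : Y → F → G} {V : Set (Y × F)} (hv : FamilySmoothOn v V)
    (hu : FamilySmoothOn u U) (hU : IsOpen U) (hUV : ∀ p ∈ U, (p.1, u p.1 p.2) ∈ V) :
    FamilySmoothOn (fun y x => v y (u y x)) U := fun n => (hv n).comp (hu n) hU hUV

theorem fderiv (h : FamilySmoothOn u U) : FamilySmoothOn (fun y x => fderiv ℝ (u y) x) U :=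
  fun n => (h (n + 1)).2.2

theorem differentiableAt (h : FamilySmoothOn u U) {y : Y} {x : E} (hx : (y, x) ∈ U) :
    DifferentiableAt ℝ (u y) x := (h 1).2.1 _ hx

theorem continuousOn_iteratedFDeriv (h : FamilySmoothOn u U) (k : ℕ) :
    ContinuousOn (fun p : Y × E => iteratedFDeriv ℝ k (u p.1) p.2) U :=
  (h k).continuousOn_iteratedFDeriv le_rfl

theorem of_iteratedFDeriv (hs : ∀ p ∈ U, ContDiffAt ℝ ∞ (u p.1) p.2)
    (hc : ∀ k, ContinuousOn (fun p : Y × E => iteratedFDeriv ℝ k (u p.1) p.2) U) :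
    FamilySmoothOn u U := fun _ => .of_iteratedFDeriv hs hc

theorem contDiffOn_slice (h : FamilySmoothOn u U) (hU : IsOpen U) (y : Y) :
    ContDiffOn ℝ ∞ (u y) {x | (y, x) ∈ U} :=
  contDiffOn_infty.2 fun n => (h n).contDiffOn_slice hU y

theorem contDiffAt (h : FamilySmoothOn u U) (hU : IsOpen U) {y : Y} {x : E} (hx : (y, x) ∈ U) :
    ContDiffAt ℝ ∞ (u y) x :=
  (h.contDiffOn_slice hU y).contDiffAt
    ((hU.preimage (Continuous.prodMk_right y)).mem_nhds hx)

theorem of_contDiffOn {f : E → F} {S : Set E} (hf : ContDiffOn ℝ ∞ f S) (hS : IsOpen S) :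
    FamilySmoothOn (fun _ : Y => f) (univ ×ˢ S) := by
  refine .of_iteratedFDeriv (fun p hp => hf.contDiffAt (hS.mem_nhds hp.2)) fun k => ?_
  have h : ContinuousOn (iteratedFDeriv ℝ k f) S :=
    (hf.continuousOn_iteratedFDerivWithin (m := k) (by exact_mod_cast le_top)
      hS.uniqueDiffOn).congr fun x hx => (iteratedFDerivWithin_of_isOpen k hS hx).symm
  exact h.comp continuousOn_snd fun p hp => hp.2

/-- Composition with a fixed smooth map. -/
theorem contDiffOn_comp {f : F → G} {S : Set F} (hf : ContDiffOn ℝ ∞ f S) (hS : IsOpen S)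
    (hu : FamilySmoothOn u U) (hU : IsOpen U) (hUS : ∀ p ∈ U, u p.1 p.2 ∈ S) :
    FamilySmoothOn (fun y x => f (u y x)) U :=
  (of_contDiffOn (Y := Y) hf hS).comp hu hU fun p hp => ⟨mem_univ _, hUS p hp⟩

/-- The constant family of a continuous linear map. -/
theorem clm (L : E →L[ℝ] F) : FamilySmoothOn (fun (_ : Y) x => L x) U :=
  (of_contDiffOn (Y := Y) L.contDiff.contDiffOn isOpen_univ).mono fun p _ => by simp

end FamilySmoothOn

end Family

/-! ### Parametric integrals -/

section Integral

variable {Y E F : Type} [TopologicalSpace Y]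
  [NormedAddCommGroup E] [NormedSpace ℝ E] [NormedAddCommGroup F] [NormedSpace ℝ F]

/-- Since `[0,1]` is compact, the integrand near `p₀` is close to the one at `p₀` uniformly in `s`.
The integration variable counts as a parameter, so it is never differentiated. -/
theorem continuousOn_integral_family {E : Type} [NormedAddCommGroup E]
    {u : Y × ℝ → E → F} {U : Set ((Y × ℝ) × E)} {W : Set (Y × E)}
    (h : ContinuousOn (fun p : (Y × ℝ) × E => u p.1 p.2) U) (hU : IsOpen U)
    (hWU : ∀ p ∈ W, ∀ s ∈ Icc (0 : ℝ) 1, ((p.1, s), p.2) ∈ U) :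
    ContinuousOn (fun p : Y × E => ∫ s in (0 : ℝ)..1, u (p.1, s) p.2) W := by
  have hint : ∀ p ∈ W, IntervalIntegrable (fun s => u (p.1, s) p.2) MeasureTheory.volume 0 1 :=
    fun p hp => by
      refine ContinuousOn.intervalIntegrable ?_
      rw [uIcc_of_le zero_le_one]
      exact h.comp (f := fun s : ℝ => ((p.1, s), p.2)) (by fun_prop) (hWU p hp)
  intro p₀ hp₀
  refine Metric.tendsto_nhds.2 fun ε hε => ?_
  have key : ∀ᶠ p in 𝓝 p₀, ∀ s ∈ Icc (0 : ℝ) 1, ‖u (p.1, s) p.2 - u (p₀.1, s) p₀.2‖ < ε / 2 := by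
    refine isCompact_Icc.eventually_forall_of_forall_eventually fun s hs => ?_
    have hcu := h.continuousAt (hU.mem_nhds (hWU p₀ hp₀ s hs))
    have h1 : ContinuousAt (fun q : (Y × E) × ℝ => u (q.1.1, q.2) q.1.2) (p₀, s) :=
      ContinuousAt.comp (f := fun q : (Y × E) × ℝ => ((q.1.1, q.2), q.1.2))
        (g := fun p : (Y × ℝ) × E => u p.1 p.2) hcu (by fun_prop)
    have h2 : ContinuousAt (fun q : (Y × E) × ℝ => u (p₀.1, q.2) p₀.2) (p₀, s) :=
      ContinuousAt.comp (f := fun q : (Y × E) × ℝ => ((p₀.1, q.2), p₀.2))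
        (g := fun p : (Y × ℝ) × E => u p.1 p.2) hcu (by fun_prop)
    have h3 : Tendsto (fun q : (Y × E) × ℝ => ‖u (q.1.1, q.2) q.1.2 - u (p₀.1, q.2) p₀.2‖)
        (𝓝 (p₀, s)) (𝓝 0) := by
      simpa using (h1.tendsto.sub h2.tendsto).norm
    exact h3.eventually (gt_mem_nhds (half_pos hε))
  filter_upwards [nhdsWithin_le_nhds key, self_mem_nhdsWithin] with p hp hpW
  rw [dist_eq_norm, ← intervalIntegral.integral_sub (hint p hpW) (hint p₀ hp₀)]
  refine lt_of_le_of_lt (intervalIntegral.norm_integral_le_of_norm_le_const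
    (C := ε / 2) fun s hs => ?_) (by simp [hε])
  rw [uIoc_of_le zero_le_one] at hs
  exact (hp s (Ioc_subset_Icc_self hs)).le

/-- Differentiation under the integral sign. If `C` bounds the derivative over the compact segment
above `x`, then `C + 1` bounds it above all nearby points and serves as the dominating function. -/
theorem hasFDerivAt_integral_family {u : Y × ℝ → E → F} {U : Set ((Y × ℝ) × E)}
    (h : FamilyContDiffOn 1 u U) (hU : IsOpen U) {y : Y} {x : E}
    (hx : ∀ s ∈ Icc (0 : ℝ) 1, ((y, s), x) ∈ U) :
    HasFDerivAt (fun x => ∫ s in (0 : ℝ)..1, u (y, s) x)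
      (∫ s in (0 : ℝ)..1, fderiv ℝ (u (y, s)) x) x := by
  have hsub : uIoc (0 : ℝ) 1 ⊆ Icc 0 1 := by
    rw [uIoc_of_le zero_le_one]
    exact Ioc_subset_Icc_self
  have hcont : ∀ {G : Type} [NormedAddCommGroup G] {v : Y × ℝ → E → G} {x : E},
      ContinuousOn (fun p : (Y × ℝ) × E => v p.1 p.2) U →
      (∀ s ∈ Icc (0 : ℝ) 1, ((y, s), x) ∈ U) → ContinuousOn (fun s => v (y, s) x) (Icc 0 1) :=
    fun {_ _ _ x} hv hx => hv.comp (f := fun s : ℝ => ((y, s), x)) (by fun_prop) hx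
  have hd : ContinuousOn (fun p : (Y × ℝ) × E => fderiv ℝ (u p.1) p.2) U := h.2.2
  obtain ⟨C, hC⟩ : ∃ C, ∀ s ∈ Icc (0 : ℝ) 1, ‖fderiv ℝ (u (y, s)) x‖ ≤ C :=
    isCompact_Icc.exists_bound_of_continuousOn (hcont (v := fun q x => fderiv ℝ (u q) x) hd hx)
  have key : ∀ᶠ x' in 𝓝 x, ∀ s ∈ Icc (0 : ℝ) 1,
      ((y, s), x') ∈ U ∧ ‖fderiv ℝ (u (y, s)) x'‖ < C + 1 := by
    refine isCompact_Icc.eventually_forall_of_forall_eventually fun s hs => ?_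
    have hg : ContinuousAt (fun q : E × ℝ => ((y, q.2), q.1)) (x, s) := by fun_prop
    have h1 : ContinuousAt (fun q : E × ℝ => ‖fderiv ℝ (u (y, q.2)) q.1‖) (x, s) :=
      (ContinuousAt.comp (f := fun q : E × ℝ => ((y, q.2), q.1))
        (g := fun p : (Y × ℝ) × E => fderiv ℝ (u p.1) p.2)
        (hd.continuousAt (hU.mem_nhds (hx s hs))) hg).norm
    exact (hg.eventually (hU.mem_nhds (hx s hs))).and
      (h1.eventually (gt_mem_nhds (lt_of_le_of_lt (hC s hs) (lt_add_one C))))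
  have hmeas : ∀ {G : Type} [NormedAddCommGroup G] [NormedSpace ℝ G] {f : ℝ → G},
      ContinuousOn f (Icc 0 1) → IntervalIntegrable f MeasureTheory.volume 0 1 := fun hf => by
    refine ContinuousOn.intervalIntegrable ?_
    rwa [uIcc_of_le zero_le_one]
  refine (intervalIntegral.hasFDerivAt_integral_of_dominated_of_fderiv_le
    (F := fun x s => u (y, s) x) (F' := fun x s => fderiv ℝ (u (y, s)) x)
    (bound := fun _ => C + 1) key ?_ ?_ ?_ ?_ ?_ ?_)
  · filter_upwards [key] with x' hx'
    exact (intervalIntegrable_iff.1 (hmeas (hcont h.1 fun s hs => (hx' s hs).1))).1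
  · exact hmeas (hcont h.1 hx)
  · exact (intervalIntegrable_iff.1 (hmeas (hcont (v := fun q x => fderiv ℝ (u q) x) hd hx))).1
  · exact Eventually.of_forall fun s hs x' hx' => (hx' s (hsub hs)).2.le
  · simp
  · exact Eventually.of_forall fun s hs x' hx' =>
      (h.2.1 _ (hx' s (hsub hs)).1).hasFDerivAt

theorem FamilyContDiffOn.integral {n : ℕ} {u : Y × ℝ → E → F} {U : Set ((Y × ℝ) × E)}
    {W : Set (Y × E)} (h : FamilyContDiffOn n u U) (hU : IsOpen U) (hW : IsOpen W)
    (hWU : ∀ p ∈ W, ∀ s ∈ Icc (0 : ℝ) 1, ((p.1, s), p.2) ∈ U) :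
    FamilyContDiffOn n (fun y x => ∫ s in (0 : ℝ)..1, u (y, s) x) W := by
  induction n generalizing F with
  | zero => exact continuousOn_integral_family h hU hWU
  | succ n ih =>
    have hd : ∀ p ∈ W, HasFDerivAt (fun x => ∫ s in (0 : ℝ)..1, u (p.1, s) x)
        (∫ s in (0 : ℝ)..1, _root_.fderiv ℝ (u (p.1, s)) p.2) p.2 := fun p hp =>
      hasFDerivAt_integral_family ⟨h.1, h.2.1, h.2.2.continuousOn⟩ hU (hWU p hp)
    exact ⟨continuousOn_integral_family h.1 hU hWU, fun p hp => (hd p hp).differentiableAt,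
      (ih h.2.2).congr hW fun p hp => (hd p hp).fderiv⟩

theorem FamilySmoothOn.integral {u : Y × ℝ → E → F} {U : Set ((Y × ℝ) × E)}
    {W : Set (Y × E)} (h : FamilySmoothOn u U) (hU : IsOpen U) (hW : IsOpen W)
    (hWU : ∀ p ∈ W, ∀ s ∈ Icc (0 : ℝ) 1, ((p.1, s), p.2) ∈ U) :
    FamilySmoothOn (fun y x => ∫ s in (0 : ℝ)..1, u (y, s) x) W :=
  fun n => (h n).integral hU hW hWU

end Integral

/-! ### Radial functions on the disc -/

section Radial

open Metric Complex

/-- A function on the unit disc which only depends on the norm has vanishing angular derivative. -/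
theorem fderiv_I_mul_of_radial {k : ℂ → ℝ} {w : ℂ} (hw : ‖w‖ < 1) (hd : DifferentiableAt ℝ k w)
    (hr : ∀ z z', ‖z‖ = ‖z'‖ → ‖z‖ < 1 → k z = k z') : fderiv ℝ k w (I * w) = 0 := by
  have hγ : HasDerivAt (fun θ : ℝ => exp (θ * I) * w) (I * w) 0 := by
    have h1 : HasDerivAt (fun θ : ℝ => (θ : ℂ) * I) I 0 := by
      simpa using (Complex.ofRealCLM.hasDerivAt (x := 0)).mul_const I
    simpa using (h1.cexp).mul_const w
  have h1 : HasDerivAt (fun θ : ℝ => k (exp (θ * I) * w)) (fderiv ℝ k w (I * w)) 0 := by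
    have hd' : HasFDerivAt k (fderiv ℝ k w) (exp (((0 : ℝ) : ℂ) * I) * w) := by
      simpa using hd.hasFDerivAt
    exact hd'.comp_hasDerivAt 0 hγ
  have h2 : (fun θ : ℝ => k (exp (θ * I) * w)) = fun _ => k w := by
    funext θ
    refine hr _ _ ?_ ?_ <;> simp [Complex.norm_exp_ofReal_mul_I, hw]
  rw [h2] at h1
  exact h1.unique (hasDerivAt_const _ _)

/-- For imaginary `w` the points `w + x` and `w - x` have the same norm, so `k` is even along this
horizontal line. -/
theorem fderiv_one_of_radial_of_re_eq_zero {k : ℂ → ℝ} {w : ℂ} (hw : ‖w‖ < 1) (hre : w.re = 0)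
    (hd : DifferentiableAt ℝ k w)
    (hr : ∀ z z', ‖z‖ = ‖z'‖ → ‖z‖ < 1 → k z = k z') : fderiv ℝ k w 1 = 0 := by
  have hγ : ∀ c : ℝ, HasDerivAt (fun x : ℝ => w + (c * x : ℝ)) (c : ℂ) 0 := fun c => by
    have h : HasDerivAt (fun x : ℝ => c * x) c 0 := by
      simpa using (hasDerivAt_id (0 : ℝ)).const_mul c
    simpa using h.ofReal_comp.const_add w
  have h1 : ∀ c : ℝ, HasDerivAt (fun x : ℝ => k (w + (c * x : ℝ))) (fderiv ℝ k w c) 0 :=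
    fun c => by
      have hd' : HasFDerivAt k (fderiv ℝ k w) (w + ((c * 0 : ℝ) : ℂ)) := by
        simpa using hd.hasFDerivAt
      exact hd'.comp_hasDerivAt 0 (hγ c)
  have h2 : (fun x : ℝ => k (w + ((1 : ℝ) * x : ℝ))) =ᶠ[𝓝 0]
      fun x : ℝ => k (w + ((-1 : ℝ) * x : ℝ)) := by
    have hc : ContinuousAt (fun x : ℝ => ‖w + ((1 : ℝ) * x : ℝ)‖) 0 := by fun_prop
    filter_upwards [hc.eventually (gt_mem_nhds
      (show ‖w + (((1 : ℝ) * 0 : ℝ) : ℂ)‖ < 1 by simpa using hw))] with x hx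
    refine hr _ _ ?_ hx
    rw [Complex.norm_eq_sqrt_sq_add_sq, Complex.norm_eq_sqrt_sq_add_sq]
    simp [hre]
  have h3 := (h1 1).unique ((h1 (-1)).congr_of_eventuallyEq h2)
  simp at h3
  linarith

/-- The contraction of the first coordinate by the factor `s`. -/
noncomputable def shrinkRe (s : ℝ) (z : ℂ) : ℂ := s • (z.re : ℂ) + z.im * I

theorem norm_shrinkRe_le {s : ℝ} (hs : s ∈ Icc (0 : ℝ) 1) (z : ℂ) : ‖shrinkRe s z‖ ≤ ‖z‖ := by
  rw [Complex.norm_eq_sqrt_sq_add_sq, Complex.norm_eq_sqrt_sq_add_sq]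
  refine Real.sqrt_le_sqrt ?_
  have h : (s * z.re) ^ 2 ≤ z.re ^ 2 := by
    rw [mul_pow]
    exact mul_le_of_le_one_left (sq_nonneg _) (pow_le_one₀ hs.1 hs.2)
  simpa [shrinkRe] using h

variable {Y : Type} [TopologicalSpace Y]

theorem isOpen_univ_prod_ball : IsOpen ((univ : Set Y) ×ˢ ball (0 : ℂ) 1) :=
  isOpen_univ.prod isOpen_ball

theorem familySmoothOn_shrinkRe (U : Set ((Y × ℝ) × ℂ)) (hU : IsOpen U) :
    FamilySmoothOn (fun q : Y × ℝ => shrinkRe q.2) U := by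
  have h1 : FamilySmoothOn (fun (q : Y × ℝ) (z : ℂ) => (z.re : ℂ)) U :=
    .clm (Complex.ofRealCLM.comp Complex.reCLM)
  have h2 : FamilySmoothOn (fun (q : Y × ℝ) (z : ℂ) => (z.im : ℂ) * I) U :=
    .clm (((ContinuousLinearMap.mul ℝ ℂ).flip I).comp (Complex.ofRealCLM.comp Complex.imCLM))
  have h3 : FamilySmoothOn (fun (q : Y × ℝ) (_ : ℂ) => q.2) U := .of_param continuous_snd
  exact (h3.smul h1 hU).add h2 hU

/-- A smooth family of functions on the disc which only depend on the norm and vanish at the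
origin is divisible by the square of the norm. -/
theorem exists_radial_quotient {K : Y → ℂ → ℝ} (hK : FamilySmoothOn K (univ ×ˢ ball 0 1))
    (hr : ∀ y z z', ‖z‖ = ‖z'‖ → ‖z‖ < 1 → K y z = K y z') (h0 : ∀ y, K y 0 = 0) :
    ∃ Q : Y → ℂ → ℝ, FamilySmoothOn Q (univ ×ˢ ball 0 1) ∧
      ∀ y, ∀ z ∈ ball (0 : ℂ) 1, K y z = ‖z‖ ^ 2 * Q y z := by
  have hB : IsOpen ((univ : Set Y) ×ˢ ball (0 : ℂ) 1) := isOpen_univ_prod_ball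
  -- `D = ∂K/∂x` vanishes on the imaginary axis, hence by Hadamard's lemma `D = x N`, where `N` is
  -- the average of `∂D/∂x` over the horizontal segment from the axis to `z`.
  let D (y : Y) (z : ℂ) : ℝ := fderiv ℝ (K y) z 1
  have hD : FamilySmoothOn D (univ ×ˢ ball 0 1) :=
    hK.fderiv.clm_apply (ContinuousLinearMap.apply ℝ ℝ (1 : ℂ)) hB
  let D₂ (y : Y) (z : ℂ) : ℝ := fderiv ℝ (D y) z 1
  have hD₂ : FamilySmoothOn D₂ (univ ×ˢ ball 0 1) :=
    hD.fderiv.clm_apply (ContinuousLinearMap.apply ℝ ℝ (1 : ℂ)) hB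
  let N (y : Y) (z : ℂ) : ℝ := ∫ s in (0 : ℝ)..1, D₂ y (shrinkRe s z)
  have hpull : ∀ {f : Y → ℂ → ℝ}, FamilySmoothOn f (univ ×ˢ ball 0 1) →
      FamilySmoothOn (fun q : Y × ℝ => f q.1) (univ ×ˢ ball 0 1) := fun hf =>
    (hf.reparam continuous_fst).mono fun p hp => ⟨mem_univ _, hp.2⟩
  have hN : FamilySmoothOn N (univ ×ˢ ball 0 1) := by
    have hcont : Continuous fun p : (Y × ℝ) × ℂ => shrinkRe p.1.2 p.2 := by
      unfold shrinkRe; fun_prop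
    have hU : IsOpen {p : (Y × ℝ) × ℂ | shrinkRe p.1.2 p.2 ∈ ball (0 : ℂ) 1} :=
      isOpen_ball.preimage hcont
    refine FamilySmoothOn.integral (u := fun q z => D₂ q.1 (shrinkRe q.2 z))
      ((hpull hD₂).comp (familySmoothOn_shrinkRe _ hU) hU fun p hp => ⟨mem_univ _, hp⟩) hU hB ?_
    intro p hp s hs
    have := hp.2
    rw [mem_ball_zero_iff] at this
    exact mem_ball_zero_iff.2 ((norm_shrinkRe_le hs _).trans_lt this)
  -- The Euler derivative of `K` will be `|z|² N`, so integrating `(1/s) |sz|² N(sz)` along the ray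
  -- produces `|z|²` times this integral.
  let Q (y : Y) (z : ℂ) : ℝ := ∫ s in (0 : ℝ)..1, s • N y (s • z)
  have hQ : FamilySmoothOn Q (univ ×ˢ ball 0 1) := by
    have hcont : Continuous fun p : (Y × ℝ) × ℂ => p.1.2 • p.2 := by fun_prop
    have hU : IsOpen {p : (Y × ℝ) × ℂ | p.1.2 • p.2 ∈ ball (0 : ℂ) 1} :=
      isOpen_ball.preimage hcont
    have h3 : FamilySmoothOn (fun (q : Y × ℝ) (_ : ℂ) => q.2)
        {p : (Y × ℝ) × ℂ | p.1.2 • p.2 ∈ ball (0 : ℂ) 1} := .of_param continuous_snd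
    refine FamilySmoothOn.integral (u := fun q z => q.2 • N q.1 (q.2 • z))
      (h3.smul ((hpull hN).comp (h3.smul (.clm (.id ℝ ℂ)) hU) hU
        fun p hp => ⟨mem_univ _, hp⟩) hU) hU hB ?_
    intro p hp s hs
    have := hp.2
    rw [mem_ball_zero_iff] at this
    refine mem_ball_zero_iff.2 (lt_of_le_of_lt ?_ this)
    rw [norm_smul, Real.norm_of_nonneg hs.1]
    exact mul_le_of_le_one_left (norm_nonneg _) hs.2
  refine ⟨Q, hQ, fun y => ?_⟩
  have hslice : ∀ {f : Y → ℂ → ℝ}, FamilySmoothOn f (univ ×ˢ ball 0 1) →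
      ContDiffOn ℝ ∞ (f y) (ball 0 1) := fun hf =>
    (hf.contDiffOn_slice hB y).mono fun z hz => ⟨mem_univ _, hz⟩
  have hdiff : ∀ {f : Y → ℂ → ℝ}, FamilySmoothOn f (univ ×ˢ ball 0 1) → ∀ z ∈ ball (0 : ℂ) 1,
      DifferentiableAt ℝ (f y) z := fun hf z hz => hf.differentiableAt ⟨mem_univ _, hz⟩
  have hrad : ∀ z ∈ ball (0 : ℂ) 1, D y z = z.re * N y z := by
    intro z hz
    have hmem : ∀ s ∈ Icc (0 : ℝ) 1, shrinkRe s z ∈ ball (0 : ℂ) 1 := fun s hs =>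
      mem_ball_zero_iff.2 ((norm_shrinkRe_le hs z).trans_lt (mem_ball_zero_iff.1 hz))
    have hder : ∀ s ∈ uIcc (0 : ℝ) 1,
        HasDerivAt (fun s => D y (shrinkRe s z)) (z.re * D₂ y (shrinkRe s z)) s := by
      intro s hs
      rw [uIcc_of_le zero_le_one] at hs
      have h1 : HasDerivAt (fun s => shrinkRe s z) (z.re : ℂ) s := by
        simpa [shrinkRe] using
          ((hasDerivAt_id s).smul_const (z.re : ℂ)).add_const ((z.im : ℂ) * I)
      have h2 := (hdiff hD _ (hmem s hs)).hasFDerivAt.comp_hasDerivAt s h1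
      have h3 : fderiv ℝ (D y) (shrinkRe s z) (z.re : ℂ) = z.re * D₂ y (shrinkRe s z) := by
        have := (fderiv ℝ (D y) (shrinkRe s z)).map_smul z.re 1
        simpa using this
      rwa [h3] at h2
    have hcont : ContinuousOn (fun s => z.re * D₂ y (shrinkRe s z)) (uIcc 0 1) := by
      rw [uIcc_of_le zero_le_one]
      refine continuousOn_const.mul ((hslice hD₂).continuousOn.comp ?_ hmem)
      unfold shrinkRe; fun_prop
    have h := intervalIntegral.integral_eq_sub_of_hasDerivAt hder hcont.intervalIntegrable
    rw [intervalIntegral.integral_const_mul] at h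
    have e1 : shrinkRe 1 z = z := by simp [shrinkRe, Complex.re_add_im]
    have e0 : D y (shrinkRe 0 z) = 0 := by
      have hm := hmem 0 (by simp)
      exact fderiv_one_of_radial_of_re_eq_zero (mem_ball_zero_iff.1 hm) (by simp [shrinkRe])
        (hdiff hK _ hm) (hr y)
    rw [e1, e0, sub_zero] at h
    exact h.symm
  -- The vanishing angular derivative reads `x ∂K/∂y = y ∂K/∂x = x y N`; dividing by `x` gives
  -- `∂K/∂y = y N`.
  have heuler : ∀ z ∈ ball (0 : ℂ) 1, z.re ≠ 0 → fderiv ℝ (K y) z z = ‖z‖ ^ 2 * N y z := by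
    intro z hz hre
    have hlin : ∀ a b : ℝ, fderiv ℝ (K y) z (a + b * I) = a * D y z + b * fderiv ℝ (K y) z I :=
      fun a b => by
        have := (fderiv ℝ (K y) z).map_add (a • 1) (b • I)
        rw [map_smul, map_smul] at this
        simpa [D] using this
    have h1 := fderiv_I_mul_of_radial (mem_ball_zero_iff.1 hz) (hdiff hK _ hz) (hr y)
    have e1 : I * z = ((-z.im : ℝ) : ℂ) + (z.re : ℝ) * I := by
      apply Complex.ext <;> simp
    rw [e1, hlin, hrad z hz] at h1
    have h2 : fderiv ℝ (K y) z I = z.im * N y z := by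
      apply mul_left_cancel₀ hre
      linear_combination h1
    have h3 := hlin z.re z.im
    rw [Complex.re_add_im, hrad z hz, h2] at h3
    rw [h3, Complex.sq_norm, Complex.normSq_apply]
    ring
  have hmain : ∀ z ∈ ball (0 : ℂ) 1, z.re ≠ 0 → K y z = ‖z‖ ^ 2 * Q y z := by
    intro z hz hre
    have hmem : ∀ s ∈ Icc (0 : ℝ) 1, s • z ∈ ball (0 : ℂ) 1 := fun s hs => by
      rw [mem_ball_zero_iff] at hz ⊢
      refine lt_of_le_of_lt ?_ hz
      rw [norm_smul, Real.norm_of_nonneg hs.1]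
      exact mul_le_of_le_one_left (norm_nonneg _) hs.2
    have hder : ∀ s ∈ uIcc (0 : ℝ) 1,
        HasDerivAt (fun s : ℝ => K y (s • z)) (fderiv ℝ (K y) (s • z) z) s := by
      intro s hs
      rw [uIcc_of_le zero_le_one] at hs
      have h1 : HasDerivAt (fun s : ℝ => s • z) z s := by
        simpa using (hasDerivAt_id s).smul_const z
      exact (hdiff hK _ (hmem s hs)).hasFDerivAt.comp_hasDerivAt s h1
    have hcont : ContinuousOn (fun s : ℝ => fderiv ℝ (K y) (s • z) z) (uIcc 0 1) := by
      rw [uIcc_of_le zero_le_one]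
      have hc : ContinuousOn (fderiv ℝ (K y)) (ball 0 1) :=
        (hslice hK).continuousOn_fderiv_of_isOpen isOpen_ball (by simp)
      exact (hc.comp (by fun_prop) hmem).clm_apply continuousOn_const
    have h := intervalIntegral.integral_eq_sub_of_hasDerivAt hder hcont.intervalIntegrable
    rw [one_smul, zero_smul, h0, sub_zero] at h
    rw [← h, ← intervalIntegral.integral_const_mul]
    refine intervalIntegral.integral_congr_ae (Eventually.of_forall fun s hs => ?_)
    rw [uIoc_of_le zero_le_one] at hs
    have he := heuler (s • z) (hmem s (Ioc_subset_Icc_self hs)) (by simp [hre, hs.1.ne'])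
    rw [map_smul, norm_smul, Real.norm_of_nonneg hs.1.le] at he
    apply mul_left_cancel₀ hs.1.ne'
    simp only [smul_eq_mul] at he ⊢
    linear_combination he
  intro z hz
  by_cases hre : z.re = 0
  -- The imaginary axis was excluded by the division by `x`; there the identity follows by
  -- continuity, approaching horizontally.
  · have hf : ContinuousAt (fun w => K y w - ‖w‖ ^ 2 * Q y w) z := by
      have := isOpen_ball.mem_nhds hz
      exact ((hslice hK).continuousOn.continuousAt this).sub
        ((by fun_prop : ContinuousAt (fun w : ℂ => ‖w‖ ^ 2) z).mul
          ((hslice hQ).continuousOn.continuousAt this))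
    have hγ : ContinuousAt (fun x : ℝ => z + x) 0 := by fun_prop
    have e0 : z + ((0 : ℝ) : ℂ) = z := by simp
    have hlim : ContinuousAt (fun x : ℝ => K y (z + x) - ‖z + x‖ ^ 2 * Q y (z + x)) 0 :=
      ContinuousAt.comp (f := fun x : ℝ => z + x)
        (g := fun w => K y w - ‖w‖ ^ 2 * Q y w) (by rwa [e0]) hγ
    have hb : ∀ᶠ x : ℝ in 𝓝[≠] 0, z + x ∈ ball (0 : ℂ) 1 :=
      nhdsWithin_le_nhds (hγ.preimage_mem_nhds (isOpen_ball.mem_nhds (by rwa [e0])))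
    have hzero : ∀ᶠ x : ℝ in 𝓝[≠] 0, K y (z + x) - ‖z + x‖ ^ 2 * Q y (z + x) = 0 := by
      filter_upwards [hb, self_mem_nhdsWithin] with x hx hx0
      rw [hmain _ hx (by simpa [hre] using hx0), sub_self]
    have h1 := (hlim.tendsto.mono_left (nhdsWithin_le_nhds (s := {0}ᶜ)))
    have h2 := tendsto_nhds_unique (h1.congr' hzero) tendsto_const_nhds
    rw [e0] at h2
    linarith
  · exact hmain z hz hre

end Radial

/-! ### The strong Whitney topology in terms of families of smooth maps -/

section WhitneyFamily

variable {E : Type} [NormedAddCommGroup E] [NormedSpace ℝ E]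
  {M : Type} [TopologicalSpace M] [ChartedSpace E M]
  {Y : Type} [TopologicalSpace Y]

theorem contDiffAt_in_charts {f : M → M} {φ ψ : OpenPartialHomeomorph M E}
    (hφ : φ ∈ IsManifold.maximalAtlas 𝓘(ℝ, E) ∞ M)
    (hψ : ψ ∈ IsManifold.maximalAtlas 𝓘(ℝ, E) ∞ M) {v : E} (hv : v ∈ φ.target)
    (hf : ContMDiffAt 𝓘(ℝ, E) 𝓘(ℝ, E) ∞ f (φ.symm v)) (hfv : f (φ.symm v) ∈ ψ.source) :
    ContDiffAt ℝ ∞ (fun w => ψ (f (φ.symm w))) v := by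
  rw [← contMDiffAt_iff_contDiffAt]
  have h1 : ContMDiffAt 𝓘(ℝ, E) 𝓘(ℝ, E) ∞ φ.symm v :=
    contMDiffAt_symm_of_mem_maximalAtlas hφ hv
  have h2 : ContMDiffAt 𝓘(ℝ, E) 𝓘(ℝ, E) ∞ ψ (f (φ.symm v)) :=
    contMDiffAt_of_mem_maximalAtlas hψ hfv
  exact h2.comp v (hf.comp v h1)

theorem contMDiffAt_of_contDiffAt_in_charts {f : M → M} {φ ψ : OpenPartialHomeomorph M E}
    (hφ : φ ∈ IsManifold.maximalAtlas 𝓘(ℝ, E) ∞ M)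
    (hψ : ψ ∈ IsManifold.maximalAtlas 𝓘(ℝ, E) ∞ M) {x : M} (hx : x ∈ φ.source)
    (hfx : ∀ᶠ w in 𝓝 (φ x), f (φ.symm w) ∈ ψ.source)
    (hf : ContDiffAt ℝ ∞ (fun w => ψ (f (φ.symm w))) (φ x)) :
    ContMDiffAt 𝓘(ℝ, E) 𝓘(ℝ, E) ∞ f x := by
  have h1 : ContMDiffAt 𝓘(ℝ, E) 𝓘(ℝ, E) ∞ φ x := contMDiffAt_of_mem_maximalAtlas hφ hx
  have hfx' : f x ∈ ψ.source := by simpa [φ.left_inv hx] using hfx.self_of_nhds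
  have h2 : ContMDiffAt 𝓘(ℝ, E) 𝓘(ℝ, E) ∞ ψ.symm (ψ (f (φ.symm (φ x)))) := by
    rw [φ.left_inv hx]
    exact contMDiffAt_symm_of_mem_maximalAtlas hψ (ψ.map_source hfx')
  have h3 := ContMDiffAt.comp x (g := fun w => ψ.symm (ψ (f (φ.symm w))))
    (ContMDiffAt.comp (φ x) (g := ψ.symm) (f := fun w => ψ (f (φ.symm w))) h2 hf.contMDiffAt) h1
  refine h3.congr_of_eventuallyEq ?_
  filter_upwards [(φ.continuousAt hx).eventually hfx, φ.open_source.mem_nhds hx] with z hz hzs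
  rw [φ.left_inv hzs] at hz
  simp only [Function.comp_apply, φ.left_inv hzs, ψ.left_inv hz]

/-- Uniform closeness of derivatives on a compact set in one pair of charts is an open condition. -/
theorem isOpen_strongNhd {f : SmoothMaps E M} {φ ψ : OpenPartialHomeomorph M E}
    (hφ : φ ∈ IsManifold.maximalAtlas 𝓘(ℝ, E) ∞ M)
    (hψ : ψ ∈ IsManifold.maximalAtlas 𝓘(ℝ, E) ∞ M) {K : Set M} (hK : IsCompact K)
    (hKφ : K ⊆ φ.source) (hKψ : MapsTo f K ψ.source) {ε : ℝ} (hε : 0 < ε) (r : ℕ) :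
    IsOpen[strongWhitneyTopology E M] (strongNhd (ι := Unit) f (fun _ => φ) (fun _ => ψ)
      (fun _ => K) (fun _ => ε) r) :=
  TopologicalSpace.isOpen_generateFrom_of_mem ⟨Unit, f, fun _ => φ, fun _ => ψ, fun _ => K,
    fun _ => ε, r, fun _ => hφ, fun _ => hψ, locallyFinite_of_finite _,
    fun _ => ⟨hK, hKφ, hKψ⟩, fun _ => hε, rfl⟩

variable {Γ : Y → SmoothMaps E M}

/-- What continuity into the Whitney topology gives on one compact set: a one-member family of
charts is already a subbasic neighbourhood. -/
theorem eventually_strongNhd (hΓ : Continuous[_, strongWhitneyTopology E M] Γ)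
    {φ ψ : OpenPartialHomeomorph M E}
    (hφ : φ ∈ IsManifold.maximalAtlas 𝓘(ℝ, E) ∞ M)
    (hψ : ψ ∈ IsManifold.maximalAtlas 𝓘(ℝ, E) ∞ M) {y₀ : Y} {K : Set M} (hK : IsCompact K)
    (hKφ : K ⊆ φ.source) (hKψ : MapsTo (Γ y₀) K ψ.source) {ε : ℝ} (hε : 0 < ε) (r : ℕ) :
    ∀ᶠ y in 𝓝 y₀, ∀ x ∈ K, Γ y x ∈ ψ.source ∧ ∀ k ≤ r,
      ‖iteratedFDeriv ℝ k (ψ ∘ Γ y ∘ φ.symm) (φ x) -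
        iteratedFDeriv ℝ k (ψ ∘ Γ y₀ ∘ φ.symm) (φ x)‖ < ε := by
  let _ := strongWhitneyTopology E M
  have ho := (isOpen_strongNhd (f := Γ y₀) hφ hψ hK hKφ hKψ hε r).preimage hΓ
  have hmem : y₀ ∈ Γ ⁻¹' (strongNhd (ι := Unit) (Γ y₀) (fun _ => φ) (fun _ => ψ)
      (fun _ => K) (fun _ => ε) r) := fun _ x hx => ⟨hKψ hx, fun k _ => by simpa using hε⟩
  filter_upwards [ho.mem_nhds hmem] with y hy x hx using hy () x hx

theorem exists_compact_chart {E M : Type} [NormedAddCommGroup E] [TopologicalSpace M]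
    [LocallyCompactSpace M] {f : M → M} (hf : Continuous f)
    {φ ψ : OpenPartialHomeomorph M E} {x : M} (hx : x ∈ φ.source) (hfx : f x ∈ ψ.source) :
    ∃ K ∈ 𝓝 x, IsCompact K ∧ K ⊆ φ.source ∧ MapsTo f K ψ.source := by
  obtain ⟨K, hK, hsub, hKc⟩ := local_compact_nhds
    ((φ.open_source.inter (ψ.open_source.preimage hf)).mem_nhds ⟨hx, hfx⟩)
  exact ⟨K, hK, hKc, fun z hz => (hsub hz).1, fun z hz => (hsub hz).2⟩

/-- An `ε/2` argument: order-zero closeness of `Γ y` to `Γ y₀`, uniform on a compact neighbourhood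
of `x₀`, together with continuity of the single map `Γ y₀`. -/
theorem continuous_eval_family [IsManifold 𝓘(ℝ, E) ∞ M] [LocallyCompactSpace M]
    (hΓ : Continuous[_, strongWhitneyTopology E M] Γ) :
    Continuous fun p : Y × M => Γ p.1 p.2 := by
  refine continuous_iff_continuousAt.2 fun ⟨y₀, x₀⟩ => ?_
  let φ := chartAt E x₀
  let ψ := chartAt E (Γ y₀ x₀)
  have hφ : φ ∈ IsManifold.maximalAtlas 𝓘(ℝ, E) ∞ M := IsManifold.chart_mem_maximalAtlas x₀
  have hψ : ψ ∈ IsManifold.maximalAtlas 𝓘(ℝ, E) ∞ M := IsManifold.chart_mem_maximalAtlas _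
  have hcont : Continuous (Γ y₀) := (Γ y₀).contMDiff.continuous
  have hs : Γ y₀ x₀ ∈ ψ.source := mem_chart_source E _
  obtain ⟨K, hK, hKc, hKφ, hKψ⟩ := exists_compact_chart hcont
    (φ := φ) (ψ := ψ) (mem_chart_source E x₀) hs
  have hlim : Tendsto (fun p : Y × M => ψ (Γ p.1 p.2)) (𝓝 (y₀, x₀)) (𝓝 (ψ (Γ y₀ x₀))) := by
    refine Metric.tendsto_nhds.2 fun ε hε => ?_
    have h1 := eventually_strongNhd hΓ hφ hψ hKc hKφ hKψ (half_pos hε) 0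
    have h2 : ∀ᶠ x in 𝓝 x₀, dist (ψ (Γ y₀ x)) (ψ (Γ y₀ x₀)) < ε / 2 :=
      Metric.tendsto_nhds.1 (ContinuousAt.comp (f := Γ y₀) (ψ.continuousAt hs)
        hcont.continuousAt).tendsto _ (half_pos hε)
    rw [nhds_prod_eq]
    filter_upwards [h1.prod_mk (h2.and hK)] with ⟨y, x⟩ ⟨hy, hx, hxK⟩
    have h3 := (hy x hxK).2 0 le_rfl
    simp only [iteratedFDeriv_zero_eq_comp, Function.comp_apply, ← map_sub,
      LinearIsometryEquiv.norm_map, φ.left_inv (hKφ hxK)] at h3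
    calc dist (ψ (Γ y x)) (ψ (Γ y₀ x₀)) ≤ dist (ψ (Γ y x)) (ψ (Γ y₀ x)) +
          dist (ψ (Γ y₀ x)) (ψ (Γ y₀ x₀)) := dist_triangle _ _ _
      _ < ε / 2 + ε / 2 := add_lt_add (by rwa [dist_eq_norm]) hx
      _ = ε := add_halves ε
  have hmem : ∀ᶠ p : Y × M in 𝓝 (y₀, x₀), Γ p.1 p.2 ∈ ψ.source := by
    have h1 := eventually_strongNhd hΓ hφ hψ hKc hKφ hKψ one_pos 0
    rw [nhds_prod_eq]
    filter_upwards [h1.prod_mk (show ∀ᶠ x in 𝓝 x₀, x ∈ K from hK)] with ⟨y, x⟩ ⟨hy, hx⟩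
      using (hy x hx).1
  have h := (ψ.symm.continuousAt (x := ψ (Γ y₀ x₀)) (ψ.map_source hs)).tendsto.comp hlim
  rw [ψ.left_inv hs] at h
  refine h.congr' ?_
  filter_upwards [hmem] with p hp using ψ.left_inv hp

theorem isOpen_chart_domain (hc : Continuous fun p : Y × M => Γ p.1 p.2)
    (φ ψ : OpenPartialHomeomorph M E) :
    IsOpen {p : Y × E | p.2 ∈ φ.target ∧ Γ p.1 (φ.symm p.2) ∈ ψ.source} := by
  have h : ContinuousOn (fun p : Y × E => Γ p.1 (φ.symm p.2)) (univ ×ˢ φ.target) :=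
    hc.comp_continuousOn (f := fun p : Y × E => (p.1, φ.symm p.2)) (continuousOn_fst.prodMk
      (φ.continuousOn_symm.comp continuousOn_snd fun p hp => hp.2))
  have := h.isOpen_inter_preimage (isOpen_univ.prod φ.open_target) ψ.open_source
  convert this using 1
  ext p
  simp

/-- The same `ε/2` argument, applied to the derivatives of each order `k` in charts. -/
theorem familySmoothOn_eval [LocallyCompactSpace M]
    (hΓ : Continuous[_, strongWhitneyTopology E M] Γ)
    {φ ψ : OpenPartialHomeomorph M E}
    (hφ : φ ∈ IsManifold.maximalAtlas 𝓘(ℝ, E) ∞ M)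
    (hψ : ψ ∈ IsManifold.maximalAtlas 𝓘(ℝ, E) ∞ M) :
    FamilySmoothOn (fun y v => ψ (Γ y (φ.symm v)))
      {p : Y × E | p.2 ∈ φ.target ∧ Γ p.1 (φ.symm p.2) ∈ ψ.source} := by
  have hs : ∀ p ∈ {p : Y × E | p.2 ∈ φ.target ∧ Γ p.1 (φ.symm p.2) ∈ ψ.source},
      ContDiffAt ℝ ∞ (fun v => ψ (Γ p.1 (φ.symm v))) p.2 := fun p hp =>
    contDiffAt_in_charts hφ hψ hp.1 (Γ p.1).contMDiff.contMDiffAt hp.2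
  refine .of_iteratedFDeriv hs fun k => ?_
  rintro ⟨y₀, v₀⟩ ⟨hv₀, hv₁⟩
  refine ContinuousAt.continuousWithinAt (Metric.tendsto_nhds.2 fun ε hε => ?_)
  obtain ⟨K, hK, hKc, hKφ, hKψ⟩ := exists_compact_chart (Γ y₀).contMDiff.continuous
    (φ.map_target hv₀) hv₁
  have h1 := eventually_strongNhd hΓ hφ hψ hKc hKφ hKψ (half_pos hε) k
  have hc : ContinuousAt (iteratedFDeriv ℝ k (fun v => ψ (Γ y₀ (φ.symm v)))) v₀ :=
    (hs (y₀, v₀) ⟨hv₀, hv₁⟩).iteratedFDeriv_right (m := 0) (i := k) (by simpa using by exact_mod_cast le_top) |>.continuousAt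
  have h2 := Metric.tendsto_nhds.1 hc.tendsto _ (half_pos hε)
  have h3 : ∀ᶠ v in 𝓝 v₀, φ.symm v ∈ K := (φ.symm.continuousAt hv₀).eventually hK
  rw [nhds_prod_eq]
  filter_upwards [h1.prod_mk (h2.and (h3.and (φ.open_target.mem_nhds hv₀)))]
    with ⟨y, v⟩ ⟨hy, hv, hvK, hvt⟩
  have h4 := (hy _ hvK).2 k le_rfl
  rw [φ.right_inv hvt] at h4
  calc dist (iteratedFDeriv ℝ k (fun v => ψ (Γ y (φ.symm v))) v)
        (iteratedFDeriv ℝ k (fun v => ψ (Γ y₀ (φ.symm v))) v₀)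
      ≤ dist (iteratedFDeriv ℝ k (fun v => ψ (Γ y (φ.symm v))) v)
          (iteratedFDeriv ℝ k (fun v => ψ (Γ y₀ (φ.symm v))) v) +
        dist (iteratedFDeriv ℝ k (fun v => ψ (Γ y₀ (φ.symm v))) v)
          (iteratedFDeriv ℝ k (fun v => ψ (Γ y₀ (φ.symm v))) v₀) := dist_triangle _ _ _
    _ < ε / 2 + ε / 2 := add_lt_add (by rw [dist_eq_norm]; exact h4) hv
    _ = ε := add_halves ε

/-- A map into the space of smooth maps of a compact manifold is continuous if it is locally
given by smooth families in charts. -/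
theorem continuous_strongWhitney_of_charts [CompactSpace M]
    (h : ∀ (y₀ : Y) (x₀ : M), ∃ φ ∈ IsManifold.maximalAtlas 𝓘(ℝ, E) ∞ M,
      ∃ ψ ∈ IsManifold.maximalAtlas 𝓘(ℝ, E) ∞ M, ∃ U : Set (Y × E), IsOpen U ∧
        x₀ ∈ φ.source ∧ (y₀, φ x₀) ∈ U ∧ (∀ p ∈ U, Γ p.1 (φ.symm p.2) ∈ ψ.source) ∧
        FamilySmoothOn (fun y v => ψ (Γ y (φ.symm v))) U) :
    Continuous[_, strongWhitneyTopology E M] Γ := by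
  have hc : Continuous fun p : Y × M => Γ p.1 p.2 := by
    refine continuous_iff_continuousAt.2 fun ⟨y₀, x₀⟩ => ?_
    obtain ⟨φ, hφ, ψ, hψ, U, hU, hx, hyU, hUψ, hs⟩ := h y₀ x₀
    have hg : ContinuousAt (fun p : Y × M => (p.1, φ p.2)) (y₀, x₀) :=
      continuousAt_fst.prodMk (ContinuousAt.comp (f := Prod.snd) (φ.continuousAt hx)
        continuousAt_snd)
    have h1 : ContinuousAt (fun p : Y × M => ψ (Γ p.1 (φ.symm (φ p.2)))) (y₀, x₀) :=
      ContinuousAt.comp (f := fun p : Y × M => (p.1, φ p.2))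
        (hs.continuousOn.continuousAt (hU.mem_nhds hyU)) hg
    have h2 : ContinuousAt (fun p : Y × M => ψ.symm (ψ (Γ p.1 (φ.symm (φ p.2))))) (y₀, x₀) :=
      ContinuousAt.comp (f := fun p : Y × M => ψ (Γ p.1 (φ.symm (φ p.2))))
        (ψ.symm.continuousAt (ψ.map_source (hUψ _ hyU))) h1
    refine h2.congr ?_
    filter_upwards [hg.eventually (hU.mem_nhds hyU),
      continuousAt_snd.eventually (φ.open_source.mem_nhds hx)] with p hp hp2
    rw [ψ.left_inv (hUψ _ hp), φ.left_inv hp2]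
  refine continuous_generateFrom_iff.2 ?_
  rintro _ ⟨ι, f, φ', ψ', K, ε, r, hφ', hψ', hlf, hK, hε, rfl⟩
  -- Compactness makes the strong topology no finer than needed: only finitely many chart domains
  -- are nonempty, and an empty domain forces `K i` to be empty and imposes no condition.
  have hfin : {i | ((φ' i).source).Nonempty}.Finite := hlf.finite_nonempty_of_compact
  refine isOpen_iff_mem_nhds.2 fun y₀ hy₀ => ?_
  have key : ∀ᶠ y in 𝓝 y₀, ∀ i ∈ {i | ((φ' i).source).Nonempty}, ∀ x ∈ K i,
      Γ y x ∈ (ψ' i).source ∧ ∀ k ≤ r,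
        ‖iteratedFDeriv ℝ k (ψ' i ∘ Γ y ∘ (φ' i).symm) (φ' i x) -
          iteratedFDeriv ℝ k (ψ' i ∘ f ∘ (φ' i).symm) (φ' i x)‖ < ε i := by
    refine hfin.eventually_all.2 fun i _ =>
      (hK i).1.eventually_forall_of_forall_eventually fun x₀ hx₀ => ?_
    obtain ⟨hm, hlt⟩ := hy₀ i x₀ hx₀
    have hxs : x₀ ∈ (φ' i).source := (hK i).2.1 hx₀
    refine (hc.continuousAt.eventually ((ψ' i).open_source.mem_nhds hm)).and ?_
    obtain ⟨φ, hφ, ψ, hψ, U, hU, hx, hyU, hUψ, hs⟩ := h y₀ x₀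
    -- The hypothesis speaks of the charts `φ`, `ψ`, the neighbourhood of `φ' i`, `ψ' i`. Composing
    -- with the two transition maps, on domains `T` and `T'`, carries smoothness of the family from
    -- one pair to the other.
    let T := ((φ' i).symm.trans φ).source
    let T' := (ψ.symm.trans (ψ' i)).source
    have hτ : ContDiffOn ℝ ∞ (fun v => φ ((φ' i).symm v)) T := fun v hv =>
      (contDiffAt_in_charts (f := id) (hφ' i) hφ hv.1 contMDiffAt_id hv.2).contDiffWithinAt
    have hτ' : ContDiffOn ℝ ∞ (fun v => ψ' i (ψ.symm v)) T' := fun v hv =>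
      (contDiffAt_in_charts (f := id) hψ (hψ' i) hv.1 contMDiffAt_id hv.2).contDiffWithinAt
    have hT : IsOpen T := ((φ' i).symm.trans φ).open_source
    have hT' : IsOpen T' := (ψ.symm.trans (ψ' i)).open_source
    have hU₁ : IsOpen ((univ ×ˢ T) ∩ (fun p : Y × E => (p.1, φ ((φ' i).symm p.2))) ⁻¹' U) :=
      (continuousOn_fst.prodMk (hτ.continuousOn.comp continuousOn_snd
        fun p hp => hp.2)).isOpen_inter_preimage (isOpen_univ.prod hT) hU
    set U₁ := (univ ×ˢ T) ∩ (fun p : Y × E => (p.1, φ ((φ' i).symm p.2))) ⁻¹' U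
    have hf₁ : FamilySmoothOn (fun (_ : Y) v => φ ((φ' i).symm v)) U₁ :=
      (FamilySmoothOn.of_contDiffOn hτ hT).mono inter_subset_left
    have hf₂ : FamilySmoothOn (fun y v => ψ (Γ y (φ.symm (φ ((φ' i).symm v))))) U₁ :=
      hs.comp hf₁ hU₁ fun p hp => hp.2
    have hU₂ : IsOpen (U₁ ∩ (fun p : Y × E => ψ (Γ p.1 (φ.symm (φ ((φ' i).symm p.2))))) ⁻¹' T') :=
      hf₂.continuousOn.isOpen_inter_preimage hU₁ hT'
    set U₂ := U₁ ∩ (fun p : Y × E => ψ (Γ p.1 (φ.symm (φ ((φ' i).symm p.2))))) ⁻¹' T'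
    have hf₃ := (hf₂.mono inter_subset_left).contDiffOn_comp hτ' hT' hU₂ fun p hp => hp.2
    have hf₄ : FamilySmoothOn (fun y v => ψ' i (Γ y ((φ' i).symm v))) U₂ := by
      refine hf₃.congr hU₂ fun p hp => ?_
      have hp1 : (p.1, φ ((φ' i).symm p.2)) ∈ U := hp.1.2
      have hp2 : (φ' i).symm p.2 ∈ φ.source := hp.1.1.2.2
      have hp3 := hUψ _ hp1
      simp only [φ.left_inv hp2] at hp3 ⊢
      rw [ψ.left_inv hp3]
    have hmem : (y₀, φ' i x₀) ∈ U₂ := by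
      have e : (φ' i).symm (φ' i x₀) = x₀ := (φ' i).left_inv hxs
      have hΓψ : Γ y₀ x₀ ∈ ψ.source := by simpa [φ.left_inv hx] using hUψ _ hyU
      refine ⟨⟨⟨mem_univ _, (φ' i).map_source hxs, ?_⟩, ?_⟩, ?_, ?_⟩
      · change (φ' i).symm (φ' i x₀) ∈ φ.source
        rwa [e]
      · simpa [e] using hyU
      · simpa [e, φ.left_inv hx] using ψ.map_source hΓψ
      · simpa [e, φ.left_inv hx, ψ.left_inv hΓψ] using hm
    refine (eventually_all_finite (finite_Iic r)).2 fun k hk => ?_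
    have hφc : ContinuousAt (φ' i) x₀ := (φ' i).continuousAt hxs
    have hc₁ : ContinuousAt (fun q : Y × M =>
        iteratedFDeriv ℝ k (ψ' i ∘ Γ q.1 ∘ (φ' i).symm) (φ' i q.2)) (y₀, x₀) :=
      ContinuousAt.comp (f := fun q : Y × M => (q.1, φ' i q.2))
        ((hf₄.continuousOn_iteratedFDeriv k).continuousAt (hU₂.mem_nhds hmem))
        (continuousAt_fst.prodMk (ContinuousAt.comp (f := Prod.snd) hφc continuousAt_snd))
    have hfs : ContDiffAt ℝ ∞ (fun v => ψ' i (f ((φ' i).symm v))) (φ' i x₀) := by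
      refine contDiffAt_in_charts (hφ' i) (hψ' i) ((φ' i).map_source hxs)
        f.contMDiff.contMDiffAt ?_
      rw [(φ' i).left_inv hxs]
      exact (hK i).2.2 hx₀
    have hc₂ : ContinuousAt (fun q : Y × M =>
        iteratedFDeriv ℝ k (ψ' i ∘ f ∘ (φ' i).symm) (φ' i q.2)) (y₀, x₀) :=
      ContinuousAt.comp (f := fun q : Y × M => φ' i q.2)
        (hfs.iteratedFDeriv_right (m := 0) (i := k) (by simpa using by exact_mod_cast le_top)).continuousAt
        (ContinuousAt.comp (f := Prod.snd) hφc continuousAt_snd)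
    exact (hc₁.sub hc₂).norm.eventually (gt_mem_nhds (hlt k hk))
  filter_upwards [key] with y hy i x hx
  exact hy i ⟨x, (hK i).2.1 hx⟩ x hx

end WhitneyFamily

/-! ### Coordinates on the lens space -/

noncomputable section

namespace LensSpace

variable (A : GluingMatrix)

/-- The height measured from the central circle of the `i`-th solid torus. -/
def sideHeight (i : Fin 2) (a : ℝ) : ℝ := if i = 0 then a else 1 - a

theorem sideHeight_inj {i : Fin 2} {a b : ℝ} : sideHeight i a = sideHeight i b ↔ a = b := by
  unfold sideHeight
  split_ifs <;> simp

theorem sideHeight_combo (i : Fin 2) (t a b : ℝ) :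
    sideHeight i ((1 - t) * a + t * b) = (1 - t) * sideHeight i a + t * sideHeight i b := by
  unfold sideHeight
  split_ifs <;> ring

theorem sideHeight_ne {i j : Fin 2} (h : i ≠ j) (a : ℝ) : sideHeight i a = 1 - sideHeight j a := by
  fin_cases i <;> fin_cases j <;> simp_all [sideHeight]

theorem exists_ne_side (i : Fin 2) : ∃ j, i ≠ j := ⟨i + 1, by fin_cases i <;> decide⟩

theorem sideHeight_height_nonneg (i : Fin 2) (m : LensSpace A) :
    0 ≤ sideHeight i (height A m) := by
  have := height_mem A m
  unfold sideHeight
  split_ifs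
  · exact this.1
  · linarith [this.2]

theorem sideHeight_incl (i : Fin 2) (x : OpenSolidTorus) :
    sideHeight i (height A (incl A i x)) = ‖x.1.2‖ ^ 2 := by
  change (if i = 0 then (if i = 0 then ‖x.1.2‖ ^ 2 else 1 - ‖x.1.2‖ ^ 2) else
    1 - (if i = 0 then ‖x.1.2‖ ^ 2 else 1 - ‖x.1.2‖ ^ 2)) = _
  split_ifs <;> simp

theorem sideHeight_incl_lt_one (i : Fin 2) (x : OpenSolidTorus) :
    sideHeight i (height A (incl A i x)) < 1 := by
  rw [sideHeight_incl]
  have := x.2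
  nlinarith [norm_nonneg x.1.2]

theorem exists_incl_of_lt_one {i : Fin 2} {m : LensSpace A}
    (h : sideHeight i (height A m) < 1) : ∃ x, incl A i x = m := by
  obtain ⟨j, x, rfl⟩ := exists_incl A m
  by_cases hij : i = j
  · exact hij ▸ ⟨x, rfl⟩
  rw [sideHeight_ne hij, sideHeight_incl] at h
  have hx : x.1.2 ≠ 0 := by
    intro h0
    simp [h0] at h
  refine ⟨⟨glue (A.side j) x.1, norm_glue_lt _ hx⟩, ?_⟩
  exact ((incl_eq_iff A).2 (Or.inr ⟨Ne.symm hij, hx, rfl⟩)).symm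

theorem exists_sideHeight_lt_one (m : LensSpace A) : ∃ i, sideHeight i (height A m) < 1 := by
  obtain ⟨i, x, rfl⟩ := exists_incl A m
  exact ⟨i, sideHeight_incl_lt_one A i x⟩

/-! ### Sliding points along the rays of the solid tori. -/

theorem norm_sqrt_mul_dir (a : ℝ) (z : ℂ) : ‖(Real.sqrt a : ℂ) * dir z‖ = Real.sqrt a := by
  rw [norm_mul, Circle.norm_coe, mul_one, Complex.norm_real, Real.norm_eq_abs,
    abs_of_nonneg (Real.sqrt_nonneg _)]

/-- The point of the solid torus on the ray of `x` with `|z|² = a`. -/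
def rayPoint (x : OpenSolidTorus) (a : ℝ) (ha : a < 1) : OpenSolidTorus :=
  ⟨(x.1.1, (Real.sqrt a : ℂ) * dir x.1.2), by
    rw [norm_sqrt_mul_dir, Real.sqrt_lt' one_pos]
    simpa using ha⟩

open Classical in
/-- Moves the point `m` along the rays of the solid tori to the height `a`. -/
def move (a : ℝ) (m : LensSpace A) : LensSpace A :=
  if h : (∃ x, incl A 0 x = m) ∧ a < 1 then incl A 0 (rayPoint h.1.choose a h.2) else m

/-- `a` is a possible height for a point on the ray of `m`. -/
def Admissible (a : ℝ) (m : LensSpace A) : Prop :=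
  ∀ i, 0 ≤ sideHeight i a ∧ (sideHeight i a = 0 ↔ sideHeight i (height A m) = 0)

variable {A}

/-- The open torus `i` is the complement of the other central circle, and an admissible height
reaches the end belonging to that circle only if `m` lies on it. -/
theorem Admissible.lt_one {a : ℝ} {m : LensSpace A} (h : Admissible A a m) {i : Fin 2}
    (hi : sideHeight i (height A m) < 1) : sideHeight i a < 1 := by
  obtain ⟨j, hj⟩ := exists_ne_side i
  have h1 := (h j).1
  have h2 := (h j).2
  rw [sideHeight_ne hj] at hi ⊢
  have : sideHeight j a ≠ 0 := fun h0 => by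
    rw [h2.1 h0] at hi
    linarith
  have := lt_of_le_of_ne h1 this.symm
  linarith

theorem admissible_height (m : LensSpace A) : Admissible A (height A m) m :=
  fun i => ⟨sideHeight_height_nonneg A i m, Iff.rfl⟩

/-- `move` is defined through torus `0`, but the gluing map sends rays to rays and exchanges `a`
with `1 - a`, so the same formula holds in torus `1`. -/
theorem move_incl {i : Fin 2} {x : OpenSolidTorus} {a : ℝ} (h : Admissible A a (incl A i x))
    (ha : sideHeight i a < 1) :
    move A a (incl A i x) = incl A i (rayPoint x (sideHeight i a) ha) := by
  have h0 : ∀ {y : OpenSolidTorus} (hy : a < 1), move A a (incl A 0 y) =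
      incl A 0 (rayPoint y a hy) := by
    intro y hy
    have hex : (∃ x, incl A 0 x = incl A 0 y) ∧ a < 1 := ⟨⟨y, rfl⟩, hy⟩
    rw [move, dif_pos hex]
    congr 2
    exact (isOpenEmbedding_incl A 0).injective hex.1.choose_spec
  by_cases hi : i = 0
  · subst hi
    exact h0 ha
  obtain rfl : i = 1 := by omega
  -- On the circle `C₁`, outside torus `0`, `move` takes its default value `m`. This is correct,
  -- since admissibility leaves only the height of `C₁` itself.
  by_cases hx : x.1.2 = 0
  · have hno : ¬ ∃ y, incl A 0 y = incl A 1 x := by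
      rintro ⟨y, hy⟩
      have h1 := sideHeight_incl_lt_one A 0 y
      rw [hy, sideHeight_ne (j := 1) (by decide), sideHeight_incl, hx] at h1
      simp at h1
    have hz : sideHeight 1 a = 0 := (h 1).2.2 (by rw [sideHeight_incl, hx]; simp)
    rw [move, dif_neg fun hh => hno hh.1]
    congr 1
    refine Subtype.ext (Prod.ext rfl ?_)
    simp [rayPoint, hz, hx]
  · let y : OpenSolidTorus := ⟨glue A.inv x.1, norm_glue_lt _ hx⟩
    have hs1 : A.side 1 = A.inv := rfl
    have hxy : incl A 1 x = incl A 0 y :=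
      (incl_eq_iff A).2 (Or.inr ⟨by decide, hx, by rw [hs1]⟩)
    have hne : sideHeight 1 a ≠ 0 := fun hz => by
      have := (h 1).2.1 hz
      rw [sideHeight_incl] at this
      exact hx (by simpa using this)
    have ha1 : sideHeight 1 a = 1 - a := rfl
    have hpos : 0 < 1 - a := ha1 ▸ lt_of_le_of_ne (h 1).1 hne.symm
    rw [hxy, h0 (by linarith)]
    symm
    refine (incl_eq_iff A).2 (Or.inr ⟨by decide, ?_, ?_⟩)
    · rw [← norm_pos_iff]
      change 0 < ‖(Real.sqrt (1 - a) : ℂ) * dir x.1.2‖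
      rw [norm_sqrt_mul_dir]
      exact Real.sqrt_pos.2 hpos
    · have hd : dir ((Real.sqrt (1 - a) : ℂ) * dir x.1.2) = dir x.1.2 :=
        dir_mul (Real.sqrt_pos.2 hpos) _
      have hdy : dir y.1.2 = x.1.1 ^ A.s * dir x.1.2 ^ (-A.r) :=
        dir_mul (sqrt_pos_of_norm x.2) _
      rw [hs1]
      refine Prod.ext ?_ ?_
      · change x.1.1 ^ (-A.q) * dir x.1.2 ^ A.p =
          x.1.1 ^ (-A.q) * dir ((Real.sqrt (1 - a) : ℂ) * dir x.1.2) ^ A.p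
        rw [hd]
      · change (Real.sqrt a : ℂ) * dir y.1.2 =
          (Real.sqrt (1 - ‖(Real.sqrt (1 - a) : ℂ) * dir x.1.2‖ ^ 2) : ℂ) *
          ((x.1.1 ^ A.s * dir ((Real.sqrt (1 - a) : ℂ) * dir x.1.2) ^ (-A.r) : Circle) : ℂ)
        rw [hd, hdy, norm_sqrt_mul_dir, Real.sq_sqrt hpos.le, sub_sub_cancel]

theorem height_move {a : ℝ} {m : LensSpace A} (h : Admissible A a m) :
    height A (move A a m) = a := by
  obtain ⟨i, x, rfl⟩ := exists_incl A m
  rw [move_incl h (h.lt_one (sideHeight_incl_lt_one A i x)), ← sideHeight_inj (i := i),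
    sideHeight_incl]
  change ‖(Real.sqrt _ : ℂ) * dir x.1.2‖ ^ 2 = _
  rw [norm_sqrt_mul_dir, Real.sq_sqrt (h i).1]

theorem Admissible.move {a b : ℝ} {m : LensSpace A} (ha : Admissible A a m)
    (hb : Admissible A b m) : Admissible A b (move A a m) := fun i => by
  rw [height_move ha, (ha i).2]
  exact hb i

/-- Once the new height is a multiple `b` of the old one, the direction `z / |z|`, singular at the
centre, drops out and only a scaling by `√b` remains. All smoothness statements rest on this form.
-/
theorem move_incl_scale {i : Fin 2} {x : OpenSolidTorus} {a b : ℝ}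
    (h : Admissible A a (incl A i x)) (hab : sideHeight i a = ‖x.1.2‖ ^ 2 * b) :
    ∃ y : OpenSolidTorus, y.1 = (x.1.1, Real.sqrt b • x.1.2) ∧
      move A a (incl A i x) = incl A i y := by
  have ha := h.lt_one (sideHeight_incl_lt_one A i x)
  refine ⟨rayPoint x (sideHeight i a) ha, Prod.ext rfl ?_, move_incl h ha⟩
  change (Real.sqrt _ : ℂ) * dir x.1.2 = Real.sqrt b • x.1.2
  rw [hab, Real.sqrt_mul (sq_nonneg _), Real.sqrt_sq (norm_nonneg _)]
  conv_rhs => rw [← norm_mul_dir x.1.2]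
  rw [Complex.real_smul]
  push_cast
  ring

theorem move_height (m : LensSpace A) : move A (height A m) m = m := by
  obtain ⟨i, x, rfl⟩ := exists_incl A m
  obtain ⟨y, hy, he⟩ := move_incl_scale (admissible_height (incl A i x)) (b := 1)
    (by rw [sideHeight_incl, mul_one])
  rw [he]
  congr 1
  refine Subtype.ext ?_
  rw [hy]
  simp

theorem move_move {a b : ℝ} {m : LensSpace A} (ha : Admissible A a m) (hb : Admissible A b m) :
    move A b (move A a m) = move A b m := by
  obtain ⟨i, x, rfl⟩ := exists_incl A m
  have hi := sideHeight_incl_lt_one A i x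
  have hab := ha.move hb
  rw [move_incl ha (ha.lt_one hi)] at hab ⊢
  rw [move_incl hab (hb.lt_one hi), move_incl hb (hb.lt_one hi)]
  congr 1
  refine Subtype.ext (Prod.ext rfl ?_)
  change (Real.sqrt _ : ℂ) * dir ((Real.sqrt (sideHeight i a) : ℂ) * dir x.1.2) =
    (Real.sqrt _ : ℂ) * dir x.1.2
  -- On the central circle the direction is lost, but there both heights vanish and the direction is
  -- multiplied by `0`.
  rcases (ha i).1.eq_or_lt with h0 | h0
  · rw [(hb i).2.2 ((ha i).2.1 h0.symm)]
    simp
  · rw [dir_mul (Real.sqrt_pos.2 h0)]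

theorem lensChart_move {i : Fin 2} {c : Circle} {m : LensSpace A}
    (hm : m ∈ (lensChart A i c).source) {a b : ℝ} (h : Admissible A a m)
    (hab : sideHeight i a = sideHeight i (height A m) * b) :
    move A a m ∈ (lensChart A i c).source ∧ lensChart A i c (move A a m) =
      ((lensChart A i c m).1, Real.sqrt b • (lensChart A i c m).2) := by
  obtain ⟨x, rfl, hx⟩ := (mem_lensChart_source A i c m).1 hm
  obtain ⟨y, hy, he⟩ := move_incl_scale h (by rw [hab, sideHeight_incl])
  rw [he, lensChart_incl, lensChart_incl, hy]
  exact ⟨(mem_lensChart_source A i c _).2 ⟨y, rfl, by rwa [hy]⟩, rfl⟩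

/-! ### Charts, smoothness of the height, and compactness of the lens space. -/

variable (A)

theorem lensChart_mem_maximalAtlas (i : Fin 2) (c : Circle) :
    lensChart A i c ∈ IsManifold.maximalAtlas 𝓘(ℝ, ℝ × ℂ) ∞ (LensSpace A) :=
  IsManifold.subset_maximalAtlas ⟨(i, c), rfl⟩

theorem sideHeight_eq_norm_lensChart {i : Fin 2} {c : Circle} {m : LensSpace A}
    (hm : m ∈ (lensChart A i c).source) :
    sideHeight i (height A m) = ‖(lensChart A i c m).2‖ ^ 2 := by
  obtain ⟨x, rfl, -⟩ := (mem_lensChart_source A i c m).1 hm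
  rw [sideHeight_incl, lensChart_incl]

theorem norm_lt_one_of_mem_target {i : Fin 2} {c : Circle} {v : ℝ × ℂ}
    (hv : v ∈ (lensChart A i c).target) : ‖v.2‖ < 1 := by
  obtain ⟨x, hx, -⟩ := (mem_lensChart_source A i c _).1 ((lensChart A i c).map_target hv)
  have h := (lensChart A i c).right_inv hv
  rw [← hx, lensChart_incl] at h
  rw [← h]
  exact x.2

theorem exists_lensChart_of_lt_one {i : Fin 2} {m : LensSpace A}
    (h : sideHeight i (height A m) < 1) : ∃ c, m ∈ (lensChart A i c).source := by
  obtain ⟨x, rfl⟩ := exists_incl_of_lt_one A h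
  exact ⟨x.1.1, (mem_lensChart_source A _ _ _).2 ⟨x, rfl, by simp⟩⟩

/-- The point of the meridian disc with the coordinate `z`. -/
def discPoint (i : Fin 2) (z : ℂ) : LensSpace A := (lensChart A i 1).symm (0, z)

theorem mem_target_of_norm_lt_one (i : Fin 2) {z : ℂ} (hz : ‖z‖ < 1) :
    ((0 : ℝ), z) ∈ (lensChart A i 1).target := by
  have h := (lensChart A i 1).map_source ((mem_lensChart_source A i 1 _).2
    ⟨⟨(1, z), hz⟩, rfl, by simp⟩)
  rwa [lensChart_incl, show Complex.arg (((1 : Circle) / 1 : Circle) : ℂ) = 0 by simp] at h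

theorem sideHeight_discPoint (i : Fin 2) {z : ℂ} (hz : ‖z‖ < 1) :
    sideHeight i (height A (discPoint A i z)) = ‖z‖ ^ 2 := by
  have hv := mem_target_of_norm_lt_one A i hz
  rw [discPoint, sideHeight_eq_norm_lensChart A ((lensChart A i 1).map_target hv),
    (lensChart A i 1).right_inv hv]

theorem contDiffOn_sideHeight_lensChart_symm (i j : Fin 2) (c : Circle) :
    ContDiffOn ℝ ∞ (fun v => sideHeight i (height A ((lensChart A j c).symm v)))
      (lensChart A j c).target := by
  have h : ContDiff ℝ ∞ fun v : ℝ × ℂ => ‖v.2‖ ^ 2 := contDiff_snd.norm_sq ℝ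
  have hj : ∀ v ∈ (lensChart A j c).target,
      sideHeight j (height A ((lensChart A j c).symm v)) = ‖v.2‖ ^ 2 := fun v hv => by
    rw [sideHeight_eq_norm_lensChart A ((lensChart A j c).map_target hv),
      (lensChart A j c).right_inv hv]
  by_cases hij : i = j
  · subst hij
    exact h.contDiffOn.congr hj
  · refine (contDiff_const.sub h : ContDiff ℝ ∞ fun v : ℝ × ℂ => 1 - ‖v.2‖ ^ 2).contDiffOn.congr
      fun v hv => ?_
    rw [sideHeight_ne hij, hj v hv]

theorem continuous_height : Continuous (height A) := by
  refine continuous_iff_continuousAt.2 fun m => ?_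
  obtain ⟨⟨j, c⟩, hm⟩ := exists_lensChart A m
  have h1 : ContinuousAt (fun v => height A ((lensChart A j c).symm v)) (lensChart A j c m) :=
    (contDiffOn_sideHeight_lensChart_symm A 0 j c).continuousOn.continuousAt
      ((lensChart A j c).open_target.mem_nhds ((lensChart A j c).map_source hm))
  refine (ContinuousAt.comp (f := lensChart A j c) h1
    ((lensChart A j c).continuousAt hm)).congr ?_
  filter_upwards [(lensChart A j c).open_source.mem_nhds hm] with x hx
  rw [Function.comp_apply, (lensChart A j c).left_inv hx]

instance : LocallyCompactSpace (LensSpace A) := ChartedSpace.locallyCompactSpace (ℝ × ℂ) _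

instance : CompactSpace (LensSpace A) := by
  -- Every point has height at most `1/2` from one of the two sides, that is `|z|² ≤ 1/2` there, and
  -- `1/2 < (3/4)²`. Two compact solid tori thus cover the space.
  let T : Set OpenSolidTorus := {x | ‖x.1.2‖ ≤ 3 / 4}
  have hT : IsCompact T := by
    rw [Subtype.isCompact_iff]
    have : (Subtype.val '' T : Set (Circle × ℂ)) = univ ×ˢ Metric.closedBall 0 (3 / 4) := by
      ext x
      constructor
      · rintro ⟨y, hy, rfl⟩
        exact ⟨mem_univ _, mem_closedBall_zero_iff.2 hy⟩
      · rintro ⟨-, hx⟩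
        rw [mem_closedBall_zero_iff] at hx
        exact ⟨⟨x, by linarith⟩, hx, rfl⟩
    rw [this]
    exact isCompact_univ.prod (isCompact_closedBall _ _)
  refine ⟨?_⟩
  have : (univ : Set (LensSpace A)) = incl A 0 '' T ∪ incl A 1 '' T := by
    refine (eq_univ_of_forall fun m => ?_).symm
    have key : ∀ i, sideHeight i (height A m) ≤ 1 / 2 → m ∈ incl A i '' T := fun i hi => by
      obtain ⟨x, rfl⟩ := exists_incl_of_lt_one A (i := i) (m := m) (by linarith)
      rw [sideHeight_incl] at hi
      refine ⟨x, ?_, rfl⟩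
      change ‖x.1.2‖ ≤ 3 / 4
      nlinarith [norm_nonneg x.1.2]
    rcases le_total (height A m) (1 / 2) with h | h
    · exact Or.inl (key 0 h)
    · exact Or.inr (key 1 (by change 1 - height A m ≤ 1 / 2; linarith))
  rw [this]
  exact (hT.image (isOpenEmbedding_incl A 0).continuous).union
    (hT.image (isOpenEmbedding_incl A 1).continuous)

theorem centralCircle_eq (i : Fin 2) :
    centralCircle A i = {m | sideHeight i (height A m) = 0} := by
  ext m
  constructor
  · rintro ⟨x, hx, rfl⟩
    change sideHeight i _ = 0
    rw [sideHeight_incl, show x.1.2 = 0 from hx]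
    simp
  · intro hm
    have hm' : sideHeight i (height A m) = 0 := hm
    obtain ⟨x, rfl⟩ := exists_incl_of_lt_one A (i := i) (m := m) (by rw [hm']; exact one_pos)
    rw [sideHeight_incl] at hm'
    exact ⟨x, by simpa using hm', rfl⟩

end LensSpace

end

/-! ### The action of foliated diffeomorphisms on heights -/

noncomputable section

namespace LensSpace

variable {A : GluingMatrix}

theorem mem_diffFolPlus_iff {h : Diff (ℝ × ℂ) (LensSpace A)} : h ∈ diffFolPlus A ↔
    IsFoliated (foliation A) h ∧ ∀ i, h '' centralCircle A i = centralCircle A i := by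
  simp only [diffFolPlus, Subgroup.mem_inf, Subgroup.mem_iInf]
  rfl

theorem inv_apply_apply (h : diffFolPlus A) (m : LensSpace A) : (h⁻¹).1 (h.1 m) = m :=
  Diffeomorph.symm_apply_apply h.1 m

/-- Leaves are the level sets of the height and go to leaves, so `h` induces a map of heights;
applied to `h⁻¹` this gives its injectivity. -/
theorem height_apply_congr (h : diffFolPlus A) {m m' : LensSpace A}
    (e : height A m = height A m') : height A (h.1 m) = height A (h.1 m') := by
  obtain ⟨t, -, ht⟩ := (mem_diffFolPlus_iff.1 h.2).1 _ ⟨height A m, height_mem A m, rfl⟩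
  have h1 : h.1 m ∈ height A ⁻¹' {t} := ht ▸ ⟨m, rfl, rfl⟩
  have h2 : h.1 m' ∈ height A ⁻¹' {t} := ht ▸ ⟨m', e.symm, rfl⟩
  exact h1.trans h2.symm

theorem height_apply_inj (h : diffFolPlus A) {m m' : LensSpace A} :
    height A (h.1 m) = height A (h.1 m') ↔ height A m = height A m' := by
  refine ⟨fun e => ?_, height_apply_congr h⟩
  simpa only [inv_apply_apply] using height_apply_congr h⁻¹ e

theorem sideHeight_apply_eq_zero (h : diffFolPlus A) (i : Fin 2) (m : LensSpace A) :
    sideHeight i (height A (h.1 m)) = 0 ↔ sideHeight i (height A m) = 0 := by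
  have hC := (mem_diffFolPlus_iff.1 h.2).2 i
  have key : h.1 m ∈ centralCircle A i ↔ m ∈ centralCircle A i := by
    conv_lhs => rw [← hC]
    exact (EquivLike.injective h.1).mem_set_image
  rwa [centralCircle_eq] at key

theorem sideHeight_apply_lt_one (h : diffFolPlus A) {i : Fin 2} {m : LensSpace A}
    (hm : sideHeight i (height A m) < 1) : sideHeight i (height A (h.1 m)) < 1 := by
  obtain ⟨j, hj⟩ := exists_ne_side i
  rw [sideHeight_ne hj] at hm ⊢
  have h1 := sideHeight_height_nonneg A j (h.1 m)
  have h2 : sideHeight j (height A (h.1 m)) ≠ 0 := fun h0 => by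
    rw [(sideHeight_apply_eq_zero h j m).1 h0] at hm
    linarith
  have := lt_of_le_of_ne h1 h2.symm
  linarith

theorem admissible_height_apply (h : diffFolPlus A) (m : LensSpace A) :
    Admissible A (height A (h.1 m)) m :=
  fun i => ⟨sideHeight_height_nonneg A i _, sideHeight_apply_eq_zero h i m⟩

theorem Admissible.apply {a : ℝ} {m : LensSpace A} (ha : Admissible A a m) (h : diffFolPlus A) :
    Admissible A a (h.1 m) := fun i =>
  ⟨(ha i).1, (ha i).2.trans (sideHeight_apply_eq_zero h i m).symm⟩

theorem Admissible.combo {a b t : ℝ} {m : LensSpace A} (ha : Admissible A a m)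
    (hb : Admissible A b m) (ht : t ∈ Icc (0 : ℝ) 1) :
    Admissible A ((1 - t) * a + t * b) m := fun i => by
  have ha0 := (ha i).1
  have hb0 := (hb i).1
  have h1 : 0 ≤ (1 - t) * sideHeight i a := mul_nonneg (by linarith [ht.2]) ha0
  have h2 : 0 ≤ t * sideHeight i b := mul_nonneg ht.1 hb0
  rw [sideHeight_combo]
  refine ⟨add_nonneg h1 h2, fun h0 => ?_, fun h0 => ?_⟩
  · have h3 : (1 - t) * sideHeight i a = 0 := by linarith
    have h4 : t * sideHeight i b = 0 := by linarith
    rcases mul_eq_zero.1 h4 with h5 | h5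
    · rw [h5, sub_zero, one_mul] at h3
      exact (ha i).2.1 h3
    · exact (hb i).2.1 h5
  · rw [(ha i).2.2 h0, (hb i).2.2 h0]
    ring

/-- The map of the interval of heights induced by a foliated diffeomorphism. -/
def leafMap (h : diffFolPlus A) (a : unitInterval) : ℝ :=
  height A (h.1 (exists_height A a.2).choose)

theorem leafMap_height (h : diffFolPlus A) (m : LensSpace A) :
    leafMap h ⟨height A m, height_mem A m⟩ = height A (h.1 m) :=
  height_apply_congr h (exists_height A (height_mem A m)).choose_spec

/-- The height is a continuous surjection from a compact space onto a Hausdorff one, hence a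
quotient map, and continuity descends. -/
theorem continuous_leafMap (h : diffFolPlus A) : Continuous (leafMap h) := by
  let q : LensSpace A → unitInterval := fun m => ⟨height A m, height_mem A m⟩
  have hq : Continuous q := (continuous_height A).subtype_mk _
  have hs : Function.Surjective q := fun a =>
    ⟨(exists_height A a.2).choose, Subtype.ext (exists_height A a.2).choose_spec⟩
  have hQ : IsQuotientMap q := hq.isClosedMap.isQuotientMap hq hs
  rw [hQ.continuous_iff]
  have : leafMap h ∘ q = fun m => height A (h.1 m) := funext (leafMap_height h)
  rw [this]
  exact (continuous_height A).comp h.1.continuous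

theorem leafMap_zero (h : diffFolPlus A) : leafMap h 0 = 0 := by
  obtain ⟨m, hm⟩ := exists_height A (t := 0) (by simp)
  have e : (0 : unitInterval) = ⟨height A m, height_mem A m⟩ := Subtype.ext hm.symm
  rw [e, leafMap_height]
  exact (sideHeight_apply_eq_zero h 0 m).2 hm

theorem leafMap_one (h : diffFolPlus A) : leafMap h 1 = 1 := by
  obtain ⟨m, hm⟩ := exists_height A (t := 1) (by simp)
  have e : (1 : unitInterval) = ⟨height A m, height_mem A m⟩ := Subtype.ext hm.symm
  rw [e, leafMap_height]
  have := (sideHeight_apply_eq_zero h 1 m).2 (by simp [sideHeight, hm])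
  simp only [sideHeight, one_ne_zero, if_false] at this
  linarith

/-- A continuous injection of an interval is monotone; the images of the endpoints, where invariance
of each circle enters, decide the direction. -/
theorem strictMono_leafMap (h : diffFolPlus A) : StrictMono (leafMap h) := by
  refine (continuous_leafMap h).strictMono_of_inj_boundedOrder ?_ fun a b hab => ?_
  · change leafMap h 0 ≤ leafMap h 1
    rw [leafMap_zero, leafMap_one]
    exact zero_le_one
  · obtain ⟨m, hm⟩ := exists_height A a.2
    obtain ⟨m', hm'⟩ := exists_height A b.2
    have ea : a = ⟨height A m, height_mem A m⟩ := Subtype.ext hm.symm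
    have eb : b = ⟨height A m', height_mem A m'⟩ := Subtype.ext hm'.symm
    rw [ea, eb, leafMap_height, leafMap_height, height_apply_inj] at hab
    exact Subtype.ext (by rw [← hm, ← hm', hab])

theorem height_apply_lt (h : diffFolPlus A) {m m' : LensSpace A}
    (e : height A m < height A m') : height A (h.1 m) < height A (h.1 m') := by
  rw [← leafMap_height, ← leafMap_height]
  exact strictMono_leafMap h e

theorem sideHeight_apply_le (h : diffFolPlus A) (i : Fin 2) {m m' : LensSpace A}
    (e : sideHeight i (height A m) ≤ sideHeight i (height A m')) :
    sideHeight i (height A (h.1 m)) ≤ sideHeight i (height A (h.1 m')) := by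
  have key : ∀ {m m' : LensSpace A}, height A m ≤ height A m' →
      height A (h.1 m) ≤ height A (h.1 m') := fun {m m'} e => by
    rcases e.eq_or_lt with e | e
    · exact (height_apply_congr h e).le
    · exact (height_apply_lt h e).le
  unfold sideHeight at *
  split_ifs at *
  · exact key e
  · linarith [key (m := m') (m' := m) (by linarith)]

/-! ### The height in the meridian discs -/

/-- The height of the image of a meridian disc under a foliated diffeomorphism. -/
def discHeight (i : Fin 2) (h : diffFolPlus A) (z : ℂ) : ℝ :=
  sideHeight i (height A (h.1 (discPoint A i z)))

/-- A single meridian disc meets every leaf of the open torus, so it determines the action of `h` on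
all their heights. -/
theorem sideHeight_apply_eq_discHeight (i : Fin 2) (h : diffFolPlus A) {m : LensSpace A} {z : ℂ}
    (hz : ‖z‖ < 1) (hm : sideHeight i (height A m) = ‖z‖ ^ 2) :
    sideHeight i (height A (h.1 m)) = discHeight i h z := by
  rw [discHeight, sideHeight_inj, height_apply_inj, ← sideHeight_inj (i := i), hm,
    sideHeight_discPoint A i hz]

theorem discHeight_radial (i : Fin 2) (h : diffFolPlus A) (z z' : ℂ) (hzz : ‖z‖ = ‖z'‖)
    (hz : ‖z‖ < 1) : discHeight i h z = discHeight i h z' := by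
  rw [← sideHeight_apply_eq_discHeight i h (z := z') (hzz ▸ hz)
    (by rw [sideHeight_discPoint A i hz, hzz]), discHeight]

theorem discHeight_nonneg (i : Fin 2) (h : diffFolPlus A) (z : ℂ) : 0 ≤ discHeight i h z :=
  sideHeight_height_nonneg A i _

theorem discHeight_eq_zero_iff (i : Fin 2) (h : diffFolPlus A) {z : ℂ} (hz : ‖z‖ < 1) :
    discHeight i h z = 0 ↔ z = 0 := by
  rw [discHeight, sideHeight_apply_eq_zero, sideHeight_discPoint A i hz]
  simp

theorem discHeight_lt_one (i : Fin 2) (h : diffFolPlus A) {z : ℂ} (hz : ‖z‖ < 1) :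
    discHeight i h z < 1 := by
  refine sideHeight_apply_lt_one h ?_
  rw [sideHeight_discPoint A i hz]
  nlinarith [norm_nonneg z]

theorem discHeight_le (i : Fin 2) (h : diffFolPlus A) {z z' : ℂ} (hz' : ‖z'‖ < 1)
    (hzz : ‖z‖ ≤ ‖z'‖) : discHeight i h z ≤ discHeight i h z' := by
  refine sideHeight_apply_le h i ?_
  rw [sideHeight_discPoint A i hz', sideHeight_discPoint A i (hzz.trans_lt hz')]
  exact pow_le_pow_left₀ (norm_nonneg _) hzz 2

theorem norm_sqrt_discHeight (i : Fin 2) (h : diffFolPlus A) (z : ℂ) :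
    ‖(Real.sqrt (discHeight i h z) : ℂ)‖ ^ 2 = discHeight i h z := by
  rw [Complex.norm_real, Real.norm_eq_abs, sq_abs, Real.sq_sqrt (discHeight_nonneg i h z)]

theorem norm_sqrt_discHeight_lt (i : Fin 2) (h : diffFolPlus A) {z : ℂ} (hz : ‖z‖ < 1) :
    ‖(Real.sqrt (discHeight i h z) : ℂ)‖ < 1 := by
  have h1 := norm_sqrt_discHeight i h z
  have h2 := discHeight_lt_one i h hz
  rw [← h1] at h2
  nlinarith [norm_nonneg (Real.sqrt (discHeight i h z) : ℂ)]

/-- The real point `√K` of the disc lies on the leaf containing the image of `z`, which `h⁻¹`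
carries back to the leaf of `z`. This is how invertibility of `h` enters the estimates on `K` and
`Q`. -/
theorem discHeight_inv (i : Fin 2) (h : diffFolPlus A) {z : ℂ} (hz : ‖z‖ < 1) :
    discHeight i h⁻¹ (Real.sqrt (discHeight i h z)) = ‖z‖ ^ 2 := by
  rw [← sideHeight_apply_eq_discHeight i h⁻¹ (m := h.1 (discPoint A i z))
    (norm_sqrt_discHeight_lt i h hz) (norm_sqrt_discHeight i h z).symm, inv_apply_apply,
    sideHeight_discPoint A i hz]

theorem continuous_toContMDiffMap :
    Continuous[_, strongWhitneyTopology (ℝ × ℂ) (LensSpace A)]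
      (fun h : diffFolPlus A => Diffeomorph.toContMDiffMap h.1) := by
  let _ := strongWhitneyTopology (ℝ × ℂ) (LensSpace A)
  have h : Continuous (fun h : Diff (ℝ × ℂ) (LensSpace A) => Diffeomorph.toContMDiffMap h) :=
    continuous_induced_dom
  exact h.comp continuous_subtype_val

/-- Locally a composite of the disc inclusion `z ↦ (0, z)`, the evaluation family in charts, and the
height, which is `|z|²` or `1 - |z|²` in the target chart. -/
theorem familySmoothOn_discHeight (i : Fin 2) :
    FamilySmoothOn (discHeight (A := A) i) (univ ×ˢ Metric.ball 0 1) := by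
  refine .of_locally ?_
  rintro ⟨h₀, z₀⟩ ⟨-, hz₀⟩
  rw [mem_ball_zero_iff] at hz₀
  obtain ⟨⟨j, d⟩, hm⟩ := exists_lensChart A (h₀.1 (discPoint A i z₀))
  have hΓ := continuous_toContMDiffMap (A := A)
  have hev := familySmoothOn_eval hΓ (lensChart_mem_maximalAtlas A i 1)
    (lensChart_mem_maximalAtlas A j d)
  have hop := isOpen_chart_domain (continuous_eval_family hΓ) (lensChart A i 1) (lensChart A j d)
  set U := {p : diffFolPlus A × (ℝ × ℂ) | p.2 ∈ (lensChart A i 1).target ∧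
    (Diffeomorph.toContMDiffMap p.1.1) ((lensChart A i 1).symm p.2) ∈ (lensChart A j d).source}
  let V : Set (diffFolPlus A × ℂ) := (fun p => (p.1, ((0 : ℝ), p.2))) ⁻¹' U
  have hV : IsOpen V := hop.preimage (by fun_prop)
  refine ⟨V, hV, ⟨mem_target_of_norm_lt_one A i hz₀, hm⟩, ?_⟩
  have h1 : FamilySmoothOn (fun (_ : diffFolPlus A) (z : ℂ) => ((0 : ℝ), z)) V :=
    .clm (ContinuousLinearMap.inr ℝ ℝ ℂ)
  have h2 := hev.comp h1 hV fun p hp => hp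
  have h3 := h2.contDiffOn_comp (contDiffOn_sideHeight_lensChart_symm A i j d)
    (lensChart A j d).open_target hV fun p hp => (lensChart A j d).map_source hp.2
  refine h3.congr hV fun p hp => ?_
  simp only [(lensChart A j d).left_inv hp.2]
  rfl

/-! ### Division of the height by `|z|²`, and positivity of the quotient and of the radial
derivative. -/

theorem exists_discQuotient (i : Fin 2) : ∃ Q : diffFolPlus A → ℂ → ℝ,
    FamilySmoothOn Q (univ ×ˢ Metric.ball 0 1) ∧
      ∀ h, ∀ z ∈ Metric.ball (0 : ℂ) 1, discHeight i h z = ‖z‖ ^ 2 * Q h z :=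
  exists_radial_quotient (familySmoothOn_discHeight i) (discHeight_radial i)
    fun h => (discHeight_eq_zero_iff i h (by simp)).2 rfl

/-- The smooth function `discHeight i h z / |z|²`. -/
def discQuotient (i : Fin 2) : diffFolPlus A → ℂ → ℝ := (exists_discQuotient i).choose

theorem familySmoothOn_discQuotient (i : Fin 2) :
    FamilySmoothOn (discQuotient (A := A) i) (univ ×ˢ Metric.ball 0 1) :=
  (exists_discQuotient i).choose_spec.1

theorem discHeight_eq (i : Fin 2) (h : diffFolPlus A) {z : ℂ} (hz : ‖z‖ < 1) :
    discHeight i h z = ‖z‖ ^ 2 * discQuotient i h z :=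
  (exists_discQuotient i).choose_spec.2 h z (mem_ball_zero_iff.2 hz)

theorem contDiffAt_discHeight (i : Fin 2) (h : diffFolPlus A) {z : ℂ} (hz : ‖z‖ < 1) :
    ContDiffAt ℝ ∞ (discHeight i h) z :=
  (familySmoothOn_discHeight i).contDiffAt isOpen_univ_prod_ball
    ⟨mem_univ _, mem_ball_zero_iff.2 hz⟩

theorem contDiffAt_discQuotient (i : Fin 2) (h : diffFolPlus A) {z : ℂ} (hz : ‖z‖ < 1) :
    ContDiffAt ℝ ∞ (discQuotient i h) z :=
  (familySmoothOn_discQuotient i).contDiffAt isOpen_univ_prod_ball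
    ⟨mem_univ _, mem_ball_zero_iff.2 hz⟩

/-- Off the centre both `K` and `|z|²` are positive. At the centre, `h⁻¹ ∘ h = id` gives `Q_h(w) ·
Q_{h⁻¹}(√K_h(w)) = 1` for `w ≠ 0`; in the limit the product of the two values at `0` is `1`, so the
nonnegative number `Q_h(0)` is not `0`. -/
theorem discQuotient_pos (i : Fin 2) (h : diffFolPlus A) {z : ℂ} (hz : ‖z‖ < 1) :
    0 < discQuotient i h z := by
  have hne : ∀ (h : diffFolPlus A) {z : ℂ}, ‖z‖ < 1 → z ≠ 0 → 0 < discQuotient i h z := by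
    intro h z hz h0
    have h1 : 0 < discHeight i h z := lt_of_le_of_ne (discHeight_nonneg i h z)
      fun h2 => h0 ((discHeight_eq_zero_iff i h hz).1 h2.symm)
    rw [discHeight_eq i h hz] at h1
    exact pos_of_mul_pos_right h1 (sq_nonneg _)
  by_cases h0 : z = 0
  swap
  · exact hne h hz h0
  subst h0
  have hc : ∀ h : diffFolPlus A, ContinuousAt (discQuotient i h) 0 := fun h =>
    (contDiffAt_discQuotient i h (by simp)).continuousAt
  have hb : ∀ᶠ w : ℂ in 𝓝[≠] 0, ‖w‖ < 1 := nhdsWithin_le_nhds (by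
    filter_upwards [Metric.ball_mem_nhds (0 : ℂ) one_pos] with w hw using mem_ball_zero_iff.1 hw)
  have hd0 : (Real.sqrt (discHeight i h 0) : ℂ) = 0 := by
    rw [(discHeight_eq_zero_iff i h (by simp)).2 rfl]
    simp
  have hsq : ContinuousAt (fun w => (Real.sqrt (discHeight i h w) : ℂ)) 0 :=
    Complex.continuous_ofReal.continuousAt.comp (Real.continuous_sqrt.continuousAt.comp
      (contDiffAt_discHeight i h (by simp)).continuousAt)
  have hprod : ContinuousAt (fun w => discQuotient i h w *
      discQuotient i h⁻¹ (Real.sqrt (discHeight i h w))) 0 :=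
    (hc h).mul (ContinuousAt.comp (f := fun w => (Real.sqrt (discHeight i h w) : ℂ))
      (by rw [hd0]; exact hc h⁻¹) hsq)
  have hone : ∀ᶠ w : ℂ in 𝓝[≠] 0, discQuotient i h w *
      discQuotient i h⁻¹ (Real.sqrt (discHeight i h w)) = 1 := by
    filter_upwards [hb, self_mem_nhdsWithin] with w hw hw0
    have h1 := discHeight_inv i h hw
    rw [discHeight_eq i h⁻¹ (norm_sqrt_discHeight_lt i h hw), norm_sqrt_discHeight,
      discHeight_eq i h hw] at h1
    have h2 : ‖w‖ ^ 2 ≠ 0 := by simpa using hw0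
    rw [discHeight_eq i h hw]
    apply mul_left_cancel₀ h2
    linear_combination h1
  have hlim := tendsto_nhds_unique
    ((hprod.tendsto.mono_left (nhdsWithin_le_nhds (s := {0}ᶜ))).congr' hone) tendsto_const_nhds
  have hge : 0 ≤ discQuotient i h 0 := by
    refine ge_of_tendsto ((hc h).tendsto.mono_left (nhdsWithin_le_nhds (s := {0}ᶜ))) ?_
    filter_upwards [hb, self_mem_nhdsWithin] with w hw hw0 using (hne h hw hw0).le
  refine lt_of_le_of_ne hge fun h1 => ?_
  rw [← h1, zero_mul] at hlim
  exact zero_ne_one hlim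

/-- The height strictly increases along the rays of the meridian discs. -/
theorem fderiv_discHeight_pos (i : Fin 2) (h : diffFolPlus A) {z : ℂ} (hz : ‖z‖ < 1)
    (h0 : z ≠ 0) : 0 < fderiv ℝ (discHeight i h) z z := by
  set d := fderiv ℝ (discHeight i h) z z
  have hray : HasDerivAt (fun s : ℝ => s • z) z 1 := by
    simpa using (hasDerivAt_id (1 : ℝ)).smul_const z
  have hcder : HasDerivAt (fun s : ℝ => discHeight i h (s • z)) d 1 := by
    have h1 : HasFDerivAt (discHeight i h) (fderiv ℝ (discHeight i h) z) ((1 : ℝ) • z) := by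
      rw [one_smul]
      exact ((contDiffAt_discHeight i h hz).differentiableAt (by simp)).hasFDerivAt
    exact h1.comp_hasDerivAt 1 hray
  have hnear : ∀ᶠ s : ℝ in 𝓝 1, ‖s • z‖ < 1 := by
    have hc : ContinuousAt (fun s : ℝ => ‖s • z‖) 1 := by fun_prop
    exact hc.eventually (gt_mem_nhds (by simpa using hz))
  have hnn : 0 ≤ d := by
    obtain ⟨ε, hε, hball⟩ := Metric.eventually_nhds_iff_ball.1 hnear
    -- Radius at most `1` keeps the scaling factors nonnegative, so that `|s z|` increases with `s`.
    let s := Metric.ball (1 : ℝ) (min ε 1)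
    have hs : s ∈ 𝓝 (1 : ℝ) := Metric.ball_mem_nhds _ (lt_min hε one_pos)
    have hmono : MonotoneOn (fun s : ℝ => discHeight i h (s • z)) s := by
      intro a ha b hb hab
      refine discHeight_le i h (hball b (Metric.ball_subset_ball (min_le_left _ _) hb)) ?_
      have ha0 : 0 ≤ a := by
        have := Metric.ball_subset_ball (min_le_right _ _) ha
        rw [Real.ball_eq_Ioo] at this
        linarith [this.1]
      rw [norm_smul, norm_smul, Real.norm_of_nonneg ha0, Real.norm_of_nonneg (ha0.trans hab)]
      exact mul_le_mul_of_nonneg_right hab (norm_nonneg _)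
    have := hmono.derivWithin_nonneg (x := 1)
    rwa [derivWithin_of_mem_nhds hs, hcder.deriv] at this
  refine lt_of_le_of_ne hnn fun hd => ?_
  have hpos : 0 < discHeight i h z := lt_of_le_of_ne (discHeight_nonneg i h z)
    fun h2 => h0 ((discHeight_eq_zero_iff i h hz).1 h2.symm)
  have hsqrt : HasDerivAt (fun s : ℝ => ((Real.sqrt (discHeight i h (s • z)) : ℝ) : ℂ)) 0 1 := by
    have h1 := (hcder.sqrt (by simpa using hpos.ne')).ofReal_comp
    rw [← hd] at h1
    simpa using h1
  -- If the radial derivative vanished, so would that of `s ↦ K_{h⁻¹}(√K_h(s z)) = s² |z|²`, whose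
  -- derivative at `1` is `2 |z|²`.
  have hcomp : HasDerivAt (fun s : ℝ =>
      discHeight i h⁻¹ (Real.sqrt (discHeight i h (s • z)))) 0 1 := by
    have h1 : DifferentiableAt ℝ (discHeight i h⁻¹)
        ((Real.sqrt (discHeight i h ((1 : ℝ) • z)) : ℝ) : ℂ) :=
      (contDiffAt_discHeight i h⁻¹
        (norm_sqrt_discHeight_lt i h (by simpa using hz))).differentiableAt (by simp)
    have h2 := h1.hasFDerivAt.comp_hasDerivAt 1 hsqrt
    rw [map_zero] at h2
    exact h2
  have hquad : HasDerivAt (fun s : ℝ => s ^ 2 * ‖z‖ ^ 2) (2 * ‖z‖ ^ 2) 1 := by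
    simpa using (hasDerivAt_pow 2 (1 : ℝ)).mul_const (‖z‖ ^ 2)
  have heq : (fun s : ℝ => discHeight i h⁻¹ (Real.sqrt (discHeight i h (s • z)))) =ᶠ[𝓝 1]
      fun s : ℝ => s ^ 2 * ‖z‖ ^ 2 := by
    filter_upwards [hnear] with s hs
    rw [discHeight_inv i h hs, norm_smul, mul_pow, Real.norm_eq_abs, sq_abs]
  have := (hquad.congr_of_eventuallyEq heq).unique hcomp
  have h2 : ‖z‖ ^ 2 ≠ 0 := by simpa using h0
  exact h2 (by linarith)

end LensSpace

end

/-! ### Stretching along the rays -/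

/-- The inverse of a bijection is smooth at a point near which the bijection is given in a chart by
a smooth map with invertible derivative. -/
theorem contMDiffAt_symm_of_hasFDerivAt_equiv {E M : Type} [NormedAddCommGroup E]
    [NormedSpace ℝ E] [CompleteSpace E] [TopologicalSpace M] [ChartedSpace E M] (e : M ≃ M)
    {φ : OpenPartialHomeomorph M E} (hφ : φ ∈ IsManifold.maximalAtlas 𝓘(ℝ, E) ∞ M) {x : M}
    (hx : x ∈ φ.source) {Φ : E → E} {Φ' : E ≃L[ℝ] E}
    (he : ∀ᶠ w in 𝓝 (φ x), e (φ.symm w) ∈ φ.source ∧ φ (e (φ.symm w)) = Φ w)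
    (hΦ : ContDiffAt ℝ ∞ Φ (φ x)) (hΦ' : HasFDerivAt Φ (Φ' : E →L[ℝ] E) (φ x)) :
    ContMDiffAt 𝓘(ℝ, E) 𝓘(ℝ, E) ∞ e.symm (e x) := by
  obtain ⟨hex, hexΦ⟩ := he.self_of_nhds
  rw [φ.left_inv hx] at hex hexΦ
  have hn : (∞ : WithTop ℕ∞) ≠ 0 := by simp
  -- The inverse function theorem yields a smooth right inverse of `Φ` near `φ (e x)`; since `e` is
  -- a global bijection, it must represent `e.symm`.
  let Ψ := hΦ.localInverse hΦ' hn
  have hΨ : ContDiffAt ℝ ∞ Ψ (φ (e x)) := hexΦ ▸ hΦ.to_localInverse hΦ' hn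
  have hΨx : Ψ (φ (e x)) = φ x := by
    rw [hexΦ]
    exact hΦ.localInverse_apply_image hΦ' hn
  have hinv : ∀ᶠ w in 𝓝 (φ (e x)), Φ (Ψ w) = w := by
    rw [hexΦ]
    exact (hΦ.hasStrictFDerivAt' hΦ' hn).eventually_right_inverse
  have hnear : ∀ᶠ w in 𝓝 (φ (e x)), Ψ w ∈ φ.target ∧
      e (φ.symm (Ψ w)) ∈ φ.source ∧ φ (e (φ.symm (Ψ w))) = Φ (Ψ w) := by
    have h := (eventually_mem_set.2 (φ.open_target.mem_nhds (φ.map_source hx))).and he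
    rw [← hΨx] at h
    exact hΨ.continuousAt.eventually h
  have key : ∀ᶠ w in 𝓝 (φ (e x)), Ψ w ∈ φ.target ∧ e.symm (φ.symm w) = φ.symm (Ψ w) := by
    filter_upwards [hinv, hnear] with w h1 ⟨h2, h3, h4⟩
    refine ⟨h2, e.symm_apply_eq.2 ?_⟩
    rw [← φ.left_inv h3, h4, h1]
  refine contMDiffAt_of_contDiffAt_in_charts hφ hφ hex ?_ (hΨ.congr_of_eventuallyEq ?_)
  · filter_upwards [key] with w ⟨h1, h2⟩
    rw [h2]
    exact φ.map_target h1
  · filter_upwards [key] with w ⟨h1, h2⟩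
    rw [h2, φ.right_inv h1]

noncomputable section

namespace LensSpace

variable {A : GluingMatrix}

/-- The map which moves each point `m` along its ray to the height
`(1 - t) * height m + t * height (g m)`. -/
def stretch (g : diffFolPlus A) (t : unitInterval) (m : LensSpace A) : LensSpace A :=
  move A ((1 - (t : ℝ)) * height A m + t * height A (g.1 m)) m

theorem admissible_stretch (g : diffFolPlus A) (t : unitInterval) (m : LensSpace A) :
    Admissible A ((1 - (t : ℝ)) * height A m + t * height A (g.1 m)) m :=
  (admissible_height m).combo (admissible_height_apply g m) t.2

theorem height_stretch (g : diffFolPlus A) (t : unitInterval) (m : LensSpace A) :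
    height A (stretch g t m) = (1 - (t : ℝ)) * height A m + t * height A (g.1 m) :=
  height_move (admissible_stretch g t m)

/-- The weights `1 - t` and `t` are never both zero, so strictness survives at the ends of the
interval. -/
theorem combo_lt_combo (t : unitInterval) {a a' b b' : ℝ} (ha : a < a') (hb : b < b') :
    (1 - (t : ℝ)) * a + t * b < (1 - (t : ℝ)) * a' + t * b' := by
  rcases t.2.1.eq_or_lt with h | h
  · rw [← h]
    linarith
  · have h1 : (1 - (t : ℝ)) * a ≤ (1 - (t : ℝ)) * a' :=
      mul_le_mul_of_nonneg_left ha.le (by linarith [t.2.2])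
    have h2 : (t : ℝ) * b < t * b' := mul_lt_mul_of_pos_left hb h
    linarith

theorem height_stretch_inj (g : diffFolPlus A) (t : unitInterval) {m m' : LensSpace A} :
    height A (stretch g t m) = height A (stretch g t m') ↔ height A m = height A m' := by
  rw [height_stretch, height_stretch]
  refine ⟨fun e => ?_, fun e => by rw [e, height_apply_congr g e]⟩
  rcases lt_trichotomy (height A m) (height A m') with h | h | h
  · exact absurd e (combo_lt_combo t h (height_apply_lt g h)).ne
  · exact h
  · exact absurd e (combo_lt_combo t h (height_apply_lt g h)).ne'

/-- The map stays on rays and its effect on heights is strictly increasing. Injectivity: sliding the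
image back to the original height recovers the point. Surjectivity: the intermediate value theorem
supplies the height of a preimage on the same ray. -/
theorem bijective_stretch (g : diffFolPlus A) (t : unitInterval) :
    Function.Bijective (stretch g t) := by
  constructor
  · intro m m' e
    have h := (height_stretch_inj g t).1 (congrArg (height A) e)
    have key : ∀ m, move A (height A m) (stretch g t m) = m := fun m => by
      rw [stretch, move_move (admissible_stretch g t m) (admissible_height m), move_height]
    rw [← key m, ← key m', e, h]
  · intro m
    let τ : unitInterval → ℝ := fun a => (1 - (t : ℝ)) * a + t * leafMap g a
    have hτ : Continuous τ := by
      have := continuous_leafMap g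
      fun_prop
    have hm := height_mem A m
    obtain ⟨a, ha⟩ : height A m ∈ range τ :=
      mem_range_of_exists_le_of_exists_ge hτ ⟨0, by simpa [τ, leafMap_zero] using hm.1⟩
        ⟨1, by simpa [τ, leafMap_one] using hm.2⟩
    obtain ⟨m₀, hm₀⟩ := exists_height A a.2
    have hgm₀ : leafMap g a = height A (g.1 m₀) := by
      rw [← leafMap_height]
      congr 1
      exact Subtype.ext hm₀.symm
    -- The heights `a` and `height A m` are those of `m₀` and its stretched image, so they hit the
    -- ends `0`, `1` simultaneously.
    have hadm : Admissible A (a : ℝ) m := fun i => by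
      have h1 := admissible_stretch g t m₀ i
      have h2 : (1 - (t : ℝ)) * height A m₀ + t * height A (g.1 m₀) = height A m := by
        rw [← ha, hm₀, ← hgm₀]
      rw [h2, hm₀] at h1
      refine ⟨?_, h1.2.symm⟩
      rw [← hm₀]
      exact sideHeight_height_nonneg A i m₀
    refine ⟨move A a m, ?_⟩
    have hh : height A (move A (a : ℝ) m) = a := height_move hadm
    have hg : height A (g.1 (move A (a : ℝ) m)) = leafMap g a := by
      rw [hgm₀, height_apply_inj, hh, hm₀]
    rw [stretch, hh, hg, show (1 - (t : ℝ)) * a + t * leafMap g a = height A m from ha,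
      move_move hadm (admissible_height m), move_height]

/-- The factor by which a leaf of a solid torus is scaled by `stretch`. -/
def stretchFactor (i : Fin 2) (g : diffFolPlus A) (t : unitInterval) (z : ℂ) : ℝ :=
  1 - (t : ℝ) + t * discQuotient i g z

theorem stretchFactor_pos (i : Fin 2) (g : diffFolPlus A) (t : unitInterval) {z : ℂ}
    (hz : ‖z‖ < 1) : 0 < stretchFactor i g t z := by
  have := combo_lt_combo t zero_lt_one (discQuotient_pos i g hz)
  simpa [stretchFactor] using this

/-- The new height is `(1 - t)|z|² + t|z|² Q(z)`, so `|z|²` factors out and the scaling factor is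
smooth and positive, centre included. -/
theorem lensChart_stretch (g : diffFolPlus A) (t : unitInterval) {i : Fin 2} {c : Circle}
    {m : LensSpace A} (hm : m ∈ (lensChart A i c).source) :
    stretch g t m ∈ (lensChart A i c).source ∧ lensChart A i c (stretch g t m) =
      ((lensChart A i c m).1, Real.sqrt (stretchFactor i g t (lensChart A i c m).2) •
        (lensChart A i c m).2) := by
  refine lensChart_move hm (admissible_stretch g t m) ?_
  have hz := norm_lt_one_of_mem_target A ((lensChart A i c).map_source hm)
  have h1 := sideHeight_eq_norm_lensChart A hm
  rw [sideHeight_combo, sideHeight_apply_eq_discHeight i g hz h1, discHeight_eq i g hz, h1,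
    stretchFactor]
  ring

/-- The map `stretch` in the coordinate of the meridian disc. -/
def discStretch (i : Fin 2) (g : diffFolPlus A) (t : unitInterval) (z : ℂ) : ℂ :=
  Real.sqrt (stretchFactor i g t z) • z

theorem contDiffAt_sqrt_stretchFactor (i : Fin 2) (g : diffFolPlus A) (t : unitInterval) {z : ℂ}
    (hz : ‖z‖ < 1) : ContDiffAt ℝ ∞ (fun w => Real.sqrt (stretchFactor i g t w)) z :=
  (contDiffAt_const.add (contDiffAt_const.mul (contDiffAt_discQuotient i g hz))).sqrt
    (stretchFactor_pos i g t hz).ne'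

theorem norm_discStretch_sq (i : Fin 2) (g : diffFolPlus A) (t : unitInterval) {z : ℂ}
    (hz : ‖z‖ < 1) :
    ‖discStretch i g t z‖ ^ 2 = (1 - (t : ℝ)) * ‖z‖ ^ 2 + t * discHeight i g z := by
  rw [discStretch, norm_smul, mul_pow, Real.norm_eq_abs, sq_abs,
    Real.sq_sqrt (stretchFactor_pos i g t hz).le, discHeight_eq i g hz, stretchFactor]
  ring

/-- For `z ↦ ρ(z) z` a kernel vector satisfies `ρ v + dρ(v) z = 0`, hence is a real multiple of `z`;
such multiples are excluded by the positive radial derivative of the squared norm. -/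
theorem exists_hasFDerivAt_discStretch (i : Fin 2) (g : diffFolPlus A) (t : unitInterval) {z : ℂ}
    (hz : ‖z‖ < 1) : ∃ L : ℂ →L[ℝ] ℂ, HasFDerivAt (discStretch i g t) L z ∧
      Function.Injective L := by
  let ρ := fun w => Real.sqrt (stretchFactor i g t w)
  have hρ : HasFDerivAt ρ (fderiv ℝ ρ z) z :=
    ((contDiffAt_sqrt_stretchFactor i g t hz).differentiableAt (by simp)).hasFDerivAt
  have hρ0 : ρ z ≠ 0 := (Real.sqrt_pos.2 (stretchFactor_pos i g t hz)).ne'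
  have hL := hρ.smul (hasFDerivAt_id z)
  set L := ρ z • ContinuousLinearMap.id ℝ ℂ + (fderiv ℝ ρ z).smulRight (id z)
  have hL' : HasFDerivAt (discStretch i g t) L z := hL
  refine ⟨L, hL', (injective_iff_map_eq_zero L).2 fun v hv => ?_⟩
  have hv' : ρ z • v + fderiv ℝ ρ z v • z = 0 := hv
  obtain ⟨c, rfl⟩ : ∃ c : ℝ, v = c • z := by
    refine ⟨-((ρ z)⁻¹ * fderiv ℝ ρ z v), ?_⟩
    have h1 : ρ z • v = -(fderiv ℝ ρ z v • z) := eq_neg_of_add_eq_zero_left hv'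
    rw [neg_smul, mul_smul, ← smul_neg, ← h1, smul_smul, inv_mul_cancel₀ hρ0, one_smul]
  by_cases h0 : z = 0
  · rw [h0, smul_zero]
  have hK : HasFDerivAt (discHeight i g) (fderiv ℝ (discHeight i g) z) z :=
    ((contDiffAt_discHeight i g hz).differentiableAt (by simp)).hasFDerivAt
  have h1 := hL'.norm_sq
  have h2 := ((hasFDerivAt_id (𝕜 := ℝ) z).norm_sq.const_mul (1 - (t : ℝ))).add
    (hK.const_mul (t : ℝ))
  -- Differentiating this identity along the kernel vector `c z` gives `0` on the left and `c` times
  -- a positive number on the right.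
  have heq : (fun w => ‖discStretch i g t w‖ ^ 2) =ᶠ[𝓝 z]
      fun w => (1 - (t : ℝ)) * ‖w‖ ^ 2 + t * discHeight i g w := by
    have hc : ContinuousAt (fun w : ℂ => ‖w‖) z := by fun_prop
    filter_upwards [hc.eventually (gt_mem_nhds hz)] with w hw using norm_discStretch_sq i g t hw
  have h3 := h1.unique (h2.congr_of_eventuallyEq heq)
  have h4 := congrArg (fun B : ℂ →L[ℝ] ℝ => B (c • z)) h3
  have hpos : 0 < (1 - (t : ℝ)) * (2 * ‖z‖ ^ 2) + t * fderiv ℝ (discHeight i g) z z := by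
    have hz0 : 0 < 2 * ‖z‖ ^ 2 := by
      have := norm_pos_iff.2 h0
      positivity
    simpa using combo_lt_combo t hz0 (fderiv_discHeight_pos i g hz h0)
  have h5 : c * ((1 - (t : ℝ)) * (2 * ‖z‖ ^ 2) + t * fderiv ℝ (discHeight i g) z z) = 0 := by
    have e1 : inner ℝ z (c • z) = c * ‖z‖ ^ 2 := by
      rw [inner_smul_right, real_inner_self_eq_norm_sq]
    have e2 : fderiv ℝ (discHeight i g) z (c • z) = c * fderiv ℝ (discHeight i g) z z := by
      rw [map_smul, smul_eq_mul]
    simp only [add_apply, smul_apply,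
      ContinuousLinearMap.comp_apply, innerSL_apply_apply, hv, inner_zero_right, smul_zero,
      ContinuousLinearMap.id_apply, id, e1, e2, smul_eq_mul, nsmul_eq_mul] at h4
    push_cast at h4
    linarith
  rcases mul_eq_zero.1 h5 with h6 | h6
  · rw [h6, zero_smul]
  · exact absurd h6 hpos.ne'

theorem contDiffAt_prod_discStretch (i : Fin 2) (g : diffFolPlus A) (t : unitInterval)
    {v : ℝ × ℂ} (hv : ‖v.2‖ < 1) :
    ContDiffAt ℝ ∞ (fun w : ℝ × ℂ => (w.1, discStretch i g t w.2)) v := by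
  have h : ContDiffAt ℝ ∞ (discStretch i g t) v.2 :=
    (contDiffAt_sqrt_stretchFactor i g t hv).smul contDiffAt_id
  exact contDiffAt_fst.prodMk (h.comp v contDiffAt_snd)

theorem exists_hasFDerivAt_prod_discStretch (i : Fin 2) (g : diffFolPlus A) (t : unitInterval)
    {v : ℝ × ℂ} (hv : ‖v.2‖ < 1) : ∃ Φ' : (ℝ × ℂ) ≃L[ℝ] (ℝ × ℂ),
      HasFDerivAt (fun w : ℝ × ℂ => (w.1, discStretch i g t w.2))
        (Φ' : (ℝ × ℂ) →L[ℝ] (ℝ × ℂ)) v := by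
  obtain ⟨L, hL, hinj⟩ := exists_hasFDerivAt_discStretch i g t hv
  let B : (ℝ × ℂ) →L[ℝ] (ℝ × ℂ) :=
    (ContinuousLinearMap.fst ℝ ℝ ℂ).prod (L.comp (ContinuousLinearMap.snd ℝ ℝ ℂ))
  have hB : Function.Injective (B : (ℝ × ℂ) →ₗ[ℝ] (ℝ × ℂ)) := by
    rintro ⟨a, b⟩ ⟨a', b'⟩ h
    have h1 : a = a' := congrArg Prod.fst h
    have h2 : L b = L b' := congrArg Prod.snd h
    rw [h1, hinj h2]
  refine ⟨(LinearEquiv.ofInjectiveEndo (B : (ℝ × ℂ) →ₗ[ℝ] (ℝ × ℂ)) hB).toContinuousLinearEquiv,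
    ?_⟩
  have h : HasFDerivAt (fun w : ℝ × ℂ => (w.1, discStretch i g t w.2)) B v :=
    hasFDerivAt_fst.prodMk (hL.comp v hasFDerivAt_snd)
  convert h using 1
  exact ContinuousLinearMap.ext fun w => rfl

theorem eventually_lensChart_stretch (g : diffFolPlus A) (t : unitInterval) {i : Fin 2}
    {c : Circle} {m : LensSpace A} (hm : m ∈ (lensChart A i c).source) :
    ∀ᶠ w in 𝓝 (lensChart A i c m),
      stretch g t ((lensChart A i c).symm w) ∈ (lensChart A i c).source ∧
      lensChart A i c (stretch g t ((lensChart A i c).symm w)) =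
        (w.1, discStretch i g t w.2) := by
  filter_upwards [(lensChart A i c).open_target.mem_nhds ((lensChart A i c).map_source hm)]
    with w hw
  have h := lensChart_stretch g t ((lensChart A i c).map_target hw)
  rw [(lensChart A i c).right_inv hw] at h
  exact h

/-- The stretching map as a diffeomorphism. -/
def stretchDiff (g : diffFolPlus A) (t : unitInterval) : Diff (ℝ × ℂ) (LensSpace A) where
  toEquiv := Equiv.ofBijective (stretch g t) (bijective_stretch g t)
  contMDiff_toFun m := by
    obtain ⟨⟨i, c⟩, hm⟩ := exists_lensChart A m
    have hφ := lensChart_mem_maximalAtlas A i c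
    have hev := eventually_lensChart_stretch g t hm
    refine contMDiffAt_of_contDiffAt_in_charts hφ hφ hm (hev.mono fun w hw => hw.1) ?_
    exact (contDiffAt_prod_discStretch i g t (norm_lt_one_of_mem_target A
      ((lensChart A i c).map_source hm))).congr_of_eventuallyEq (hev.mono fun w hw => hw.2)
  contMDiff_invFun m' := by
    obtain ⟨m, rfl⟩ := (Equiv.ofBijective (stretch g t) (bijective_stretch g t)).surjective m'
    obtain ⟨⟨i, c⟩, hm⟩ := exists_lensChart A m
    have hv := norm_lt_one_of_mem_target A ((lensChart A i c).map_source hm)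
    obtain ⟨Φ', hΦ'⟩ := exists_hasFDerivAt_prod_discStretch i g t hv
    exact contMDiffAt_symm_of_hasFDerivAt_equiv _ (lensChart_mem_maximalAtlas A i c) hm
      (eventually_lensChart_stretch g t hm) (contDiffAt_prod_discStretch i g t hv) hΦ'

/-! ### The deformation -/

/-- The deformation of the foliated diffeomorphism `h` which makes the heights of `h m` and `m`
equal at the time `t = 1`. -/
def deform (t : unitInterval) (h : diffFolPlus A) : Diff (ℝ × ℂ) (LensSpace A) :=
  stretchDiff h⁻¹ t * h.1

theorem deform_apply (t : unitInterval) (h : diffFolPlus A) (m : LensSpace A) :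
    deform t h m = move A ((1 - (t : ℝ)) * height A (h.1 m) + t * height A m) (h.1 m) := by
  change stretch h⁻¹ t (h.1 m) = _
  rw [stretch, inv_apply_apply]

theorem height_deform (t : unitInterval) (h : diffFolPlus A) (m : LensSpace A) :
    height A (deform t h m) = (1 - (t : ℝ)) * height A (h.1 m) + t * height A m := by
  change height A (stretch h⁻¹ t (h.1 m)) = _
  rw [height_stretch, inv_apply_apply]

theorem height_deform_inj (t : unitInterval) (h : diffFolPlus A) {m m' : LensSpace A} :
    height A (deform t h m) = height A (deform t h m') ↔ height A m = height A m' :=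
  (height_stretch_inj h⁻¹ t).trans (height_apply_inj h)

theorem deform_mem (t : unitInterval) (h : diffFolPlus A) : deform t h ∈ diffFolPlus A := by
  have hsurj : Function.Surjective (deform t h) := EquivLike.surjective (deform t h)
  refine mem_diffFolPlus_iff.2 ⟨?_, fun i => ?_⟩
  · rintro _ ⟨a, ha, rfl⟩
    obtain ⟨m₀, rfl⟩ := exists_height A ha
    refine ⟨height A (deform t h m₀), height_mem A _, Subset.antisymm ?_ fun y hy => ?_⟩
    · rintro _ ⟨m, hm, rfl⟩
      exact (height_deform_inj t h).2 hm
    · obtain ⟨m, rfl⟩ := hsurj y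
      exact ⟨m, (height_deform_inj t h).1 hy, rfl⟩
  · have key : ∀ m, sideHeight i (height A (deform t h m)) = 0 ↔
        sideHeight i (height A m) = 0 := fun m => by
      rw [height_deform]
      exact ((admissible_height_apply h m).combo (admissible_height m) t.2 i).2
    rw [centralCircle_eq]
    refine Subset.antisymm ?_ fun y hy => ?_
    · rintro _ ⟨m, hm, rfl⟩
      exact (key m).2 hm
    · obtain ⟨m, rfl⟩ := hsurj y
      exact ⟨m, (key m).1 hy, rfl⟩

theorem mem_diffLp_iff {h : Diff (ℝ × ℂ) (LensSpace A)} :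
    h ∈ diffLp A ↔ ∀ m, height A (h m) = height A m := by
  constructor
  · intro hh m
    have h1 : h '' (height A ⁻¹' {height A m}) = height A ⁻¹' {height A m} :=
      hh _ ⟨_, height_mem A m, rfl⟩
    have h2 : h m ∈ h '' (height A ⁻¹' {height A m}) := ⟨m, rfl, rfl⟩
    rw [h1] at h2
    exact h2
  · rintro hh _ ⟨a, -, rfl⟩
    refine Subset.antisymm ?_ fun y hy => ?_
    · rintro _ ⟨m, hm, rfl⟩
      exact (hh m).trans hm
    · obtain ⟨m, rfl⟩ := EquivLike.surjective h y
      exact ⟨m, (hh m).symm.trans hy, rfl⟩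

/-- The central circles are themselves leaves, at the heights `0` and `1`. -/
theorem diffLp_le_diffFolPlus : diffLp A ≤ diffFolPlus A := by
  intro h hh
  have hleaf : IsLeafPreserving (foliation A) h := hh
  refine mem_diffFolPlus_iff.2 ⟨fun l hl => by rwa [hleaf l hl], fun i => hleaf _ ?_⟩
  refine ⟨if i = 0 then 0 else 1, by split_ifs <;> simp, ?_⟩
  rw [centralCircle_eq]
  ext m
  simp only [mem_ofPred_eq, mem_preimage, mem_singleton_iff, sideHeight]
  split_ifs
  · rfl
  · exact sub_eq_zero.trans eq_comm

theorem deform_zero (h : diffFolPlus A) : deform 0 h = h.1 := by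
  refine Diffeomorph.ext fun m => ?_
  rw [deform_apply]
  simp [move_height]

theorem deform_of_mem_diffLp (t : unitInterval) {h : diffFolPlus A} (hh : h.1 ∈ diffLp A) :
    deform t h = h.1 := by
  refine Diffeomorph.ext fun m => ?_
  have e : (1 - (t : ℝ)) * height A (h.1 m) + t * height A m = height A (h.1 m) := by
    rw [mem_diffLp_iff.1 hh m]
    ring
  rw [deform_apply, e, move_height]

theorem deform_one_mem (h : diffFolPlus A) : deform 1 h ∈ diffLp A :=
  mem_diffLp_iff.2 fun m => by simp [height_deform]

/-- The original height is that of the image divided by `Q_h(v)`, whence the factor `1 - t + t /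
Q_h(v)`. Taking `Q_h` at the source, instead of the quotient of `h⁻¹` at the image, removes
inversion from the formula, so continuity of `h ↦ h⁻¹` is never needed. -/
theorem lensChart_deform (t : unitInterval) (h : diffFolPlus A) {i : Fin 2} {c d : Circle}
    {v : ℝ × ℂ} (hv : v ∈ (lensChart A i c).target)
    (hhv : h.1 ((lensChart A i c).symm v) ∈ (lensChart A i d).source) :
    deform t h ((lensChart A i c).symm v) ∈ (lensChart A i d).source ∧
      lensChart A i d (deform t h ((lensChart A i c).symm v)) =
        ((lensChart A i d (h.1 ((lensChart A i c).symm v))).1,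
          Real.sqrt (1 - (t : ℝ) + t * (discQuotient i h v.2)⁻¹) •
            (lensChart A i d (h.1 ((lensChart A i c).symm v))).2) := by
  rw [deform_apply]
  set m := (lensChart A i c).symm v
  refine lensChart_move hhv (((admissible_height_apply h m).combo (admissible_height m)
    t.2).apply h) ?_
  have hz := norm_lt_one_of_mem_target A hv
  have h1 : sideHeight i (height A m) = ‖v.2‖ ^ 2 := by
    rw [sideHeight_eq_norm_lensChart A ((lensChart A i c).map_target hv),
      (lensChart A i c).right_inv hv]
  have hq := (discQuotient_pos i h hz).ne'
  rw [sideHeight_combo, sideHeight_apply_eq_discHeight i h hz h1, discHeight_eq i h hz, h1]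
  field_simp

/-- Both `h₀` and the deformation preserve each open solid torus, so charts of the same torus `i`
serve at source and target, and the formula of `lensChart_deform` applies near every point. -/
theorem continuous_deform : Continuous[_, strongWhitneyTopology (ℝ × ℂ) (LensSpace A)]
    (fun y : unitInterval × diffFolPlus A => Diffeomorph.toContMDiffMap (deform y.1 y.2)) := by
  refine continuous_strongWhitney_of_charts fun ⟨t₀, h₀⟩ m₀ => ?_
  obtain ⟨i, hi⟩ := exists_sideHeight_lt_one A m₀
  obtain ⟨c, hc⟩ := exists_lensChart_of_lt_one A hi
  obtain ⟨d, hd⟩ := exists_lensChart_of_lt_one A (sideHeight_apply_lt_one h₀ hi)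
  have hΓ : Continuous[_, strongWhitneyTopology (ℝ × ℂ) (LensSpace A)]
      (fun y : unitInterval × diffFolPlus A => Diffeomorph.toContMDiffMap y.2.1) := by
    let _ := strongWhitneyTopology (ℝ × ℂ) (LensSpace A)
    exact (continuous_toContMDiffMap (A := A)).comp continuous_snd
  have hφ := lensChart_mem_maximalAtlas A i c
  have hψ := lensChart_mem_maximalAtlas A i d
  have hev := familySmoothOn_eval hΓ hφ hψ
  have hU := isOpen_chart_domain (continuous_eval_family hΓ) (lensChart A i c) (lensChart A i d)
  set U := {p : (unitInterval × diffFolPlus A) × (ℝ × ℂ) | p.2 ∈ (lensChart A i c).target ∧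
    (Diffeomorph.toContMDiffMap p.1.2.1) ((lensChart A i c).symm p.2) ∈ (lensChart A i d).source}
  refine ⟨_, hφ, _, hψ, U, hU, hc, ⟨(lensChart A i c).map_source hc, ?_⟩,
    fun p hp => (lensChart_deform p.1.1 p.1.2 hp.1 hp.2).1, ?_⟩
  · change h₀.1 ((lensChart A i c).symm (lensChart A i c m₀)) ∈ _
    rwa [(lensChart A i c).left_inv hc]
  have hball : ∀ p ∈ U, ‖p.2.2‖ < 1 := fun p hp => norm_lt_one_of_mem_target A hp.1
  have hQ : FamilySmoothOn (fun (y : unitInterval × diffFolPlus A) (v : ℝ × ℂ) =>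
      discQuotient i y.2 v.2) U :=
    ((familySmoothOn_discQuotient i).reparam continuous_snd).comp
      (.clm (ContinuousLinearMap.snd ℝ ℝ ℂ)) hU
      fun p hp => ⟨mem_univ _, mem_ball_zero_iff.2 (hball p hp)⟩
  have hQpos : ∀ p ∈ U, 0 < discQuotient i p.1.2 p.2.2 := fun p hp =>
    discQuotient_pos i p.1.2 (hball p hp)
  have hinv : ContDiffOn ℝ ∞ (fun x : ℝ => x⁻¹) (Ioi 0) := fun x hx =>
    (contDiffAt_inv ℝ (ne_of_gt hx)).contDiffWithinAt
  have hsqrt : ContDiffOn ℝ ∞ Real.sqrt (Ioi 0) := fun x hx =>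
    (Real.contDiffAt_sqrt (ne_of_gt hx)).contDiffWithinAt
  have h1 := hQ.contDiffOn_comp hinv isOpen_Ioi hU hQpos
  have ht : FamilySmoothOn (fun (y : unitInterval × diffFolPlus A) (_ : ℝ × ℂ) => (y.1 : ℝ)) U :=
    .of_param (by fun_prop)
  have ht' : FamilySmoothOn
      (fun (y : unitInterval × diffFolPlus A) (_ : ℝ × ℂ) => 1 - (y.1 : ℝ)) U :=
    .of_param (by fun_prop)
  have h2 := (ht'.add (ht.smul h1 hU) hU).contDiffOn_comp hsqrt isOpen_Ioi hU fun p hp => by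
    simpa using combo_lt_combo p.1.1 zero_lt_one (inv_pos.2 (hQpos p hp))
  have h3 := (hev.clm_apply (ContinuousLinearMap.fst ℝ ℝ ℂ) hU).prodMk
    (h2.smul (hev.clm_apply (ContinuousLinearMap.snd ℝ ℝ ℂ) hU) hU) hU
  exact h3.congr hU fun p hp => (lensChart_deform p.1.1 p.1.2 hp.1 hp.2).2

end LensSpace

end

/-! ### Assembly of the deformation retraction. -/

theorem mainTheorem2 (A : GluingMatrix) :
    LensSpace.diffLp A ≤ LensSpace.diffFolPlus A ∧
      IsStrongDeformationRetract
        {h : LensSpace.diffFolPlus A |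
          (h : Diff (ℝ × ℂ) (LensSpace A)) ∈ LensSpace.diffLp A} := by
  refine ⟨LensSpace.diffLp_le_diffFolPlus, ?_⟩
  let G : unitInterval × LensSpace.diffFolPlus A → LensSpace.diffFolPlus A :=
    fun y => ⟨LensSpace.deform y.1 y.2, LensSpace.deform_mem y.1 y.2⟩
  -- The group carries the topology induced from the smooth maps, so only continuity of the
  -- underlying maps has to be known.
  have hG : Continuous G :=
    (continuous_induced_rng.2 LensSpace.continuous_deform).subtype_mk _
  refine ⟨⟨fun h => G (1, h), hG.comp (Continuous.prodMk_right 1)⟩,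
    fun h => LensSpace.deform_one_mem h, ⟨⟨⟨⟨G, hG⟩, fun h => ?_, fun h => rfl⟩, ?_⟩⟩⟩
  · exact Subtype.ext (LensSpace.deform_zero h)
  · intro t h hh
    exact Subtype.ext (LensSpace.deform_of_mem_diffLp t hh)
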